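/- Let $L,G_N,\varepsilon>0$. Represent a constant time slice of global AdS$_3$ of radius $L$ by the hyperbolic plane with metric $L^2(d\rho^2+\sinh^2\!\rho\,d\chi^2)$, and denote by $(u,v)$, $u<v<u+2\pi$, the oriented geodesic from the boundary point at angle $u$ to the one at angle $v$; put $\theta=\frac{u+v}2$, $\alpha=\frac{v-u}2$. Oriented geodesics form kinematic space $\mathcal K$ ($\theta\in[0,2\pi)$, $\alpha\in(0,\pi)$). Let $S(u,v)=\frac{L}{2G_N}\log\!\big(\frac2\varepsilon\sin\frac{v-u}2\big)$ be the (Ryu–Takayanagi) entanglement entropy of the boundary interval $[u,v]$ with cutoff $\varepsilon$, and let $\omega=\partial_u\partial_vS\,du\wedge dv$ be the Crofton form. Then $\omega=\frac{L}{4G_N}\,\frac{1}{2\sin^2((v-u)/2)}\,du\wedge dv$. For disjoint boundary intervals $A_1=[a_1,b_1]$, $A_2=[a_2,b_2]$ with $a_1<b_1<a_2<b_2<a_1+2\pi$, the causal shadow $Q$ is the region bounded by the four geodesics subtending $A_1$, $A_2$ and the two complementary intervals $[b_1,a_2]$, $[b_2,a_1+2\pi]$; $\mathcal K_Q\subset\mathcal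 K$ is the set of geodesics meeting $Q$, and $\lambda_Q(u,v)$ is the length of the intersection of the geodesic $(u,v)$ with $Q$. (1) Let $A_1=[-\frac\pi4,\frac\pi4]$ and $A_2=[\frac{3\pi}4,\frac{5\pi}4]$ (the phase transition for two equal, opposite intervals), $I=[-\frac\pi4,\frac\pi4]\times[\frac\pi4,\frac{3\pi}4]$ and $II=[-\frac\pi4,\frac\pi4]\times[\frac{3\pi}4,\frac{5\pi}4]$ in the coordinates $(u,v)$. Let $\chi_{\rm in}\in(-\frac\pi2,\frac\pi2)$, $\chi^I_{\rm out}\in(0,\pi)$, $\chi^{II}_{\rm out}\in(\frac\pi2,\frac{3\pi}2)$ be given by $$\tan\chi_{\rm in}=\frac{\sqrt2\cos\alpha-\cos\theta}{\sin\theta},\qquad \cot\chi^{I}_{\rm out}=\frac{\sqrt2\cos\alpha-\sin\theta}{\cos\theta},\qquad \tan\chi^{II}_{\rm out}=-\frac{\sqrt2\cos\alpha+\cos\theta}{\sin\theta},$$ and put $$\frac{\lambda_I}{L}=\operatorname{arctanh}\frac{\sin(\theta-\chi_{\rm in})}{\sqrt{2\cos^2\chi_{\rm in}-\cos^2(\theta-\chi_{\rm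 in})}}-\operatorname{arctanh}\frac{\sin(\theta-\chi^I_{\rm out})}{\sqrt{2\sin^2\chi^I_{\rm out}-\cos^2(\theta-\chi^I_{\rm out})}},$$ $$\frac{\lambda_{II}}{L}=\operatorname{arctanh}\frac{\sin(\theta-\chi_{\rm in})}{\sqrt{2\cos^2\chi_{\rm in}-\cos^2(\theta-\chi_{\rm in})}}-\operatorname{arctanh}\frac{\sin(\theta-\chi^{II}_{\rm out})}{\sqrt{2\cos^2\chi^{II}_{\rm out}-\cos^2(\theta-\chi^{II}_{\rm out})}}.$$ In the interiors of $I$ and $II$ these functions equal the chord $\lambda_Q$ of the causal shadow $Q$ of $A_1\cup A_2$; $\lambda_I\omega$ and $\lambda_{II}\omega$ are integrable over $I$ and $II$ respectively, and $$2\pi L^2=\frac{8G_N}{\pi}\Big(2\int_I\lambda_I\,\omega+\int_{II}\lambda_{II}\,\omega\Big).$$ (2) For every placement of $A_1$, $A_2$ as above, the volume of the causal shadow and its kinematic space integral both have this same value: $V(Q)=\frac{2G_N}{\pi}\int_{\mathcal K_Q}\lambda_Q\,\omega=2\pi L^2$. -/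

import Mathlib

open Real MeasureTheory Set
open scoped ENNReal

noncomputable section

/-! Conventions. A constant time slice of global AdS₃ of radius `L` is the hyperbolic plane with
metric `L² (dρ² + sinh² ρ dχ²)`. The point with cylindrical coordinates `(ρ, χ)` is represented by
the complex number `tanh ρ · exp (i χ)` of the open unit disc (projective model), in which geodesics
are straight chords. A pair `(u, v)` with `u < v < u + 2π` is the geodesic from the boundary point
`exp (i u)` to the boundary point `exp (i v)`; it subtends the boundary interval with centre
`θ = (u + v) / 2` and half-width `α = (v - u) / 2`. -/

/-- The point with cylindrical coordinates `(ρ, χ)`. -/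
def bulkPoint (ρ χ : ℝ) : ℂ :=
  (Real.tanh ρ : ℂ) * Complex.exp ((χ : ℂ) * Complex.I)

/-- The volume of a subset of the slice, for the volume form `L² sinh ρ dρ dχ`. -/
def sliceVolume (L : ℝ) (Q : Set ℂ) : ℝ≥0∞ :=
  ∫⁻ p in {p : ℝ × ℝ | 0 < p.1 ∧ 0 ≤ p.2 ∧ p.2 < 2 * π ∧ bulkPoint p.1 p.2 ∈ Q},
    ENNReal.ofReal (L ^ 2 * Real.sinh p.1)

/-- The oriented geodesic `(u, v)`, parametrized by arc length `s` in the metric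
`dρ² + sinh² ρ dχ²`: it tends to `exp (i u)` as `s → -∞` and to `exp (i v)` as `s → ∞`. -/
def geodesicPoint (u v s : ℝ) : ℂ :=
  Complex.exp (((u + v) / 2 : ℝ) * Complex.I) *
    ((Real.cos ((v - u) / 2) : ℂ) + (Real.sin ((v - u) / 2) * Real.tanh s : ℝ) * Complex.I)

/-- The chord `λ_Q(u, v)`: the length of the intersection of the geodesic `(u, v)` with `Q`. -/
def chordLength (L : ℝ) (Q : Set ℂ) (u v : ℝ) : ℝ≥0∞ :=
  ENNReal.ofReal L * volume {s : ℝ | geodesicPoint u v s ∈ Q}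

/-- The open region of the slice between the boundary interval `[u, v]` and its geodesic. In
cylindrical coordinates it is `tanh ρ cos (χ - θ) > cos α`. -/
def intervalRegion (u v : ℝ) : Set ℂ :=
  {z | ‖z‖ < 1 ∧
    Real.cos ((v - u) / 2) < (z * Complex.exp (-((u + v) / 2 : ℝ) * Complex.I)).re}

/-- The causal shadow of the two boundary intervals `A₁ = [a₁, b₁]` and `A₂ = [a₂, b₂]`: what
remains of the slice after removing the regions cut off by the geodesics of `A₁`, `A₂` and of the
two complementary intervals `[b₁, a₂]` and `[b₂, a₁ + 2π]`. -/
def causalShadow (a₁ b₁ a₂ b₂ : ℝ) : Set ℂ :=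
  {z | ‖z‖ < 1 ∧ z ∉ intervalRegion a₁ b₁ ∧ z ∉ intervalRegion b₁ a₂ ∧
    z ∉ intervalRegion a₂ b₂ ∧ z ∉ intervalRegion b₂ (a₁ + 2 * π)}

/-- The causal shadow of two opposite quarter circles. -/
def symmetricShadow : Set ℂ :=
  causalShadow (-(π / 4)) (π / 4) (3 * π / 4) (5 * π / 4)

/-- The oriented geodesics `(u, v)`, `θ ∈ [0, 2π)`, `α ∈ (0, π)`, that meet `Q`. -/
def kinematicRegion (Q : Set ℂ) : Set (ℝ × ℝ) :=
  {p | 0 ≤ (p.1 + p.2) / 2 ∧ (p.1 + p.2) / 2 < 2 * π ∧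
    0 < (p.2 - p.1) / 2 ∧ (p.2 - p.1) / 2 < π ∧ ∃ s : ℝ, geodesicPoint p.1 p.2 s ∈ Q}

/-- The entanglement entropy of the interval `[u, v]`: the regularized geodesic length
`2 L log ((2 / ε) sin ((v - u) / 2))` with cutoff `ε`, divided by `4 G`. -/
def entropy (L G ε u v : ℝ) : ℝ :=
  2 * L * Real.log (2 / ε * Real.sin ((v - u) / 2)) / (4 * G)

/-- The Crofton density: `ω = ∂_u ∂_v S du ∧ dv`. -/
def crofton (L G ε u v : ℝ) : ℝ :=
  deriv (fun u' => deriv (fun v' => entropy L G ε u' v') v) u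

/-- Geodesics from `A₁ = [-π/4, π/4]` to the adjacent complementary interval `[π/4, 3π/4]`. -/
def squareI : Set (ℝ × ℝ) :=
  Icc (-(π / 4)) (π / 4) ×ˢ Icc (π / 4) (3 * π / 4)

/-- Geodesics from `A₁ = [-π/4, π/4]` to `A₂ = [3π/4, 5π/4]`. -/
def squareII : Set (ℝ × ℝ) :=
  Icc (-(π / 4)) (π / 4) ×ˢ Icc (3 * π / 4) (5 * π / 4)

/-- Angle of the entry point, on the geodesic `(θ, α) = (0, π/4)`; values in `(-π/2, π/2)`. -/
def chiIn (u v : ℝ) : ℝ :=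
  Real.arctan ((√2 * Real.cos ((v - u) / 2) - Real.cos ((v + u) / 2)) / Real.sin ((v + u) / 2))

/-- Angle of the exit point for square `I`, on the geodesic `(θ, α) = (π/2, π/4)`; the branch of
the inverse cotangent is the one with values in `(0, π)`. -/
def chiOutI (u v : ℝ) : ℝ :=
  π / 2 -
    Real.arctan ((√2 * Real.cos ((v - u) / 2) - Real.sin ((v + u) / 2)) / Real.cos ((v + u) / 2))

/-- Angle of the exit point for square `II`, on the geodesic `(θ, α) = (π, π/4)`; the branch of
the inverse tangent is the one with values in `(π/2, 3π/2)`. -/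
def chiOutII (u v : ℝ) : ℝ :=
  π + Real.arctan
    (-((√2 * Real.cos ((v - u) / 2) + Real.cos ((v + u) / 2)) / Real.sin ((v + u) / 2)))

/-- The chord function `λ_I`. -/
def lambdaI (L u v : ℝ) : ℝ :=
  L * (Real.artanh (Real.sin ((v + u) / 2 - chiIn u v) /
        √(2 * Real.cos (chiIn u v) ^ 2 - Real.cos ((v + u) / 2 - chiIn u v) ^ 2)) -
      Real.artanh (Real.sin ((v + u) / 2 - chiOutI u v) /
        √(2 * Real.sin (chiOutI u v) ^ 2 - Real.cos ((v + u) / 2 - chiOutI u v) ^ 2)))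

/-- The chord function `λ_II`. -/
def lambdaII (L u v : ℝ) : ℝ :=
  L * (Real.artanh (Real.sin ((v + u) / 2 - chiIn u v) /
        √(2 * Real.cos (chiIn u v) ^ 2 - Real.cos ((v + u) / 2 - chiIn u v) ^ 2)) -
      Real.artanh (Real.sin ((v + u) / 2 - chiOutII u v) /
        √(2 * Real.cos (chiOutII u v) ^ 2 - Real.cos ((v + u) / 2 - chiOutII u v) ^ 2)))

end

/-!
The Crofton formula holds for every measurable region `Q`: the kinematic integral of the chord
length is `π / (2 G)` times the volume. By rotation invariance, integrating the chord over all
geodesics of opening `d = v - u` only sees, at each parameter `s`, the angular measure of `Q` on the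
circle through that point of the geodesic. In the coordinates `t = cot (d / 2)`,
`y = √(1 + t²) sinh s` the density becomes constant and the circle depends only on
`t² + y² = sinh² ρ`, so plane polar coordinates recover the volume.

The causal shadow is an ideal quadrilateral, and an ideal polygon with `n + 2` sides has area `n π`:
an ideal triangle with a vertex at the centre and angle `β` there has area `π - β`. At the phase
transition the quadrilateral is a square. A geodesic with both ends over the same side misses it;
the others are, up to the symmetries of the square and reversal of orientation, those of `squareI`
(ends over adjacent sides) and `squareII` (ends over opposite sides), and the total kinematic
integral is `4 (2 ∫_I + ∫_II)`. The formulas for `λ_I` and `λ_II` are the hyperbolic distance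
between the crossings of a geodesic with two sides.
-/

theorem continuous_tanh : Continuous Real.tanh := by
  simp only [funext Real.tanh_eq_sinh_div_cosh]
  exact Real.continuous_sinh.div Real.continuous_cosh fun x => (Real.cosh_pos x).ne'

@[fun_prop]
theorem measurable_tanh : Measurable Real.tanh :=
  continuous_tanh.measurable

theorem setLIntegral_Ioc_add_eq_of_periodic {T : ℝ} (hT : 0 < T) {f : ℝ → ℝ≥0∞}
    (hf : Function.Periodic f T) (a b : ℝ) :
    ∫⁻ x in Ioc a (a + T), f x = ∫⁻ x in Ioc b (b + T), f x := by
  refine (isAddFundamentalDomain_Ioc hT a).setLIntegral_eq (isAddFundamentalDomain_Ioc hT b) f ?_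
  rintro ⟨g, hg⟩ x
  obtain ⟨n, rfl⟩ := AddSubgroup.mem_zmultiples_iff.mp hg
  simpa [add_comm] using! hf.zsmul n x

theorem setLIntegral_Ioc_comp_add_right (f : ℝ → ℝ≥0∞) (a b c : ℝ) :
    ∫⁻ x in Ioc a b, f (x + c) = ∫⁻ x in Ioc (a + c) (b + c), f x := by
  have h := (measurePreserving_add_right volume c).setLIntegral_comp_preimage_emb
    (measurableEmbedding_addRight c) f (Ioc (a + c) (b + c))
  rwa [preimage_add_const_Ioc, add_sub_cancel_right, add_sub_cancel_right] at h

/-! ### The Crofton density -/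

/-- The Crofton density in closed form. Unlike `crofton` it is manifestly measurable and periodic,
and it does not involve the cutoff. -/
noncomputable def croftonDensity (L G u v : ℝ) : ℝ :=
  L / (4 * G) * (1 / (2 * Real.sin ((v - u) / 2) ^ 2))

theorem hasDerivAt_entropy_right (L G : ℝ) {ε u v : ℝ} (hε : 0 < ε)
    (h : Real.sin ((v - u) / 2) ≠ 0) :
    HasDerivAt (fun v' => entropy L G ε u v')
      (L / (4 * G) * (Real.cos ((v - u) / 2) / Real.sin ((v - u) / 2))) v := by
  have hhalf : HasDerivAt (fun v' : ℝ => (v' - u) / 2) (1 / 2) v :=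
    ((hasDerivAt_id v).sub_const u).div_const 2
  have hlog := (hhalf.sin.const_mul (2 / ε)).log (by positivity)
  convert! (hlog.const_mul (2 * L)).div_const (4 * G) using 1
  field_simp

theorem crofton_eq_croftonDensity (L G : ℝ) {ε u v : ℝ} (hε : 0 < ε)
    (h : Real.sin ((v - u) / 2) ≠ 0) : crofton L G ε u v = croftonDensity L G u v := by
  have hcont : ContinuousAt (fun u' : ℝ => Real.sin ((v - u') / 2)) u := by fun_prop
  have hfirst : (fun u' => deriv (fun v' => entropy L G ε u' v') v) =ᶠ[nhds u]
      fun u' => L / (4 * G) * (Real.cos ((v - u') / 2) / Real.sin ((v - u') / 2)) := by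
    filter_upwards [hcont.eventually_ne h] with u' hu'
    exact (hasDerivAt_entropy_right L G hε hu').deriv
  have hhalf : HasDerivAt (fun u' : ℝ => (v - u') / 2) (-1 / 2) u :=
    ((hasDerivAt_id u).const_sub v).div_const 2
  rw [crofton, hfirst.deriv_eq, ((hhalf.cos.fun_div hhalf.sin h).const_mul (L / (4 * G))).deriv,
    croftonDensity]
  congr 1
  field_simp
  linarith [Real.sin_sq_add_cos_sq ((v - u) / 2)]

theorem sin_half_sub_pos {u v : ℝ} (h : u < v) (h' : v < u + 2 * π) :
    0 < Real.sin ((v - u) / 2) :=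
  Real.sin_pos_of_pos_of_lt_pi (by linarith) (by linarith)

@[fun_prop]
theorem measurable_croftonDensity (L G : ℝ) :
    Measurable fun p : ℝ × ℝ => croftonDensity L G p.1 p.2 := by
  unfold croftonDensity
  fun_prop

theorem croftonDensity_nonneg {L G : ℝ} (hL : 0 ≤ L) (hG : 0 ≤ G) (u v : ℝ) :
    0 ≤ croftonDensity L G u v := by
  unfold croftonDensity
  positivity

theorem croftonDensity_add_add (L G u v c : ℝ) :
    croftonDensity L G (u + c) (v + c) = croftonDensity L G u v := by
  simp only [croftonDensity, add_sub_add_right_eq_sub]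

/-! ### The Crofton formula for a measurable region -/

theorem periodic_exp_ofReal_mul_I :
    Function.Periodic (fun x : ℝ => Complex.exp (x * Complex.I)) (2 * π) := fun x => by
  simpa using Complex.exp_mul_I_periodic (x : ℂ)

theorem geodesicPoint_add_add (u v c s : ℝ) :
    geodesicPoint (u + c) (v + c) s = Complex.exp (c * Complex.I) * geodesicPoint u v s := by
  have hmid : (u + c + (v + c)) / 2 = c + (u + v) / 2 := by ring
  rw [geodesicPoint, geodesicPoint, hmid, add_sub_add_right_eq_sub, Complex.ofReal_add, add_mul,
    Complex.exp_add, mul_assoc]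

theorem norm_geodesicPoint (u v s : ℝ) :
    ‖geodesicPoint u v s‖ =
      √(Real.cos ((v - u) / 2) ^ 2 + Real.sin ((v - u) / 2) ^ 2 * Real.tanh s ^ 2) := by
  rw [geodesicPoint, norm_mul, Complex.norm_exp_ofReal_mul_I, one_mul, Complex.norm_add_mul_I,
    mul_pow]

@[fun_prop]
theorem measurable_bulkPoint : Measurable fun p : ℝ × ℝ => bulkPoint p.1 p.2 := by
  unfold bulkPoint
  fun_prop

theorem measurable_geodesicPoint :
    Measurable fun p : (ℝ × ℝ) × ℝ => geodesicPoint p.1.1 p.1.2 p.2 := by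
  unfold geodesicPoint
  fun_prop

theorem measurable_geodesicPoint_right (u v : ℝ) : Measurable (geodesicPoint u v) := by
  unfold geodesicPoint
  fun_prop

theorem measurable_chordLength (L : ℝ) {Q : Set ℂ} (hQ : MeasurableSet Q) :
    Measurable fun p : ℝ × ℝ => chordLength L Q p.1 p.2 :=
  (measurable_measure_prodMk_left (measurable_geodesicPoint hQ)).const_mul _

theorem chordLength_eq_lintegral (L : ℝ) {Q : Set ℂ} (hQ : MeasurableSet Q) (u v : ℝ) :
    chordLength L Q u v = ENNReal.ofReal L * ∫⁻ s, Q.indicator 1 (geodesicPoint u v s) := by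
  have hs : MeasurableSet {s : ℝ | geodesicPoint u v s ∈ Q} :=
    measurable_geodesicPoint_right u v hQ
  rw [chordLength, ← lintegral_indicator_one hs]
  rfl

/-- The angular measure of the part of the circle of radius `r` that lies in `Q`. -/
noncomputable def circleSection (Q : Set ℂ) (r : ℝ) : ℝ≥0∞ :=
  ∫⁻ χ in Ioc 0 (2 * π), Q.indicator 1 (r * Complex.exp (χ * Complex.I))

theorem setLIntegral_indicator_exp_mul (Q : Set ℂ) (c : ℝ) (z : ℂ) :
    ∫⁻ u in Ioc c (c + 2 * π), Q.indicator 1 (Complex.exp (u * Complex.I) * z) =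
      circleSection Q ‖z‖ := by
  set f : ℝ → ℝ≥0∞ := fun χ => Q.indicator 1 (‖z‖ * Complex.exp (χ * Complex.I))
  have hf : Function.Periodic f (2 * π) := fun χ => by
    simp only [f, periodic_exp_ofReal_mul_I χ]
  have hrot (u : ℝ) :
      Complex.exp (u * Complex.I) * z = ‖z‖ * Complex.exp ((u + z.arg : ℝ) * Complex.I) := by
    nth_rewrite 1 [← Complex.norm_mul_exp_arg_mul_I z]
    rw [Complex.ofReal_add, add_mul, Complex.exp_add]
    ring
  calc ∫⁻ u in Ioc c (c + 2 * π), Q.indicator 1 (Complex.exp (u * Complex.I) * z)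
      = ∫⁻ u in Ioc c (c + 2 * π), f (u + z.arg) := by simp only [hrot, f]
    _ = ∫⁻ χ in Ioc (c + z.arg) (c + z.arg + 2 * π), f χ := by
        rw [setLIntegral_Ioc_comp_add_right, add_right_comm]
    _ = circleSection Q ‖z‖ := by
        rw [setLIntegral_Ioc_add_eq_of_periodic two_pi_pos hf _ 0, zero_add, circleSection]

@[fun_prop]
theorem measurable_circleSection {Q : Set ℂ} (hQ : MeasurableSet Q) :
    Measurable (circleSection Q) :=
  Measurable.lintegral_prod_right ((measurable_one.indicator hQ).comp
    (g := Q.indicator (1 : ℂ → ℝ≥0∞)) (by fun_prop))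

theorem sliceVolume_eq_lintegral_polar (L : ℝ) {Q : Set ℂ} (hQ : MeasurableSet Q) :
    sliceVolume L Q = ∫⁻ p in Ioi (0 : ℝ) ×ˢ Ioc 0 (2 * π),
      ENNReal.ofReal (L ^ 2 * Real.sinh p.1) * Q.indicator 1 (bulkPoint p.1 p.2) := by
  have hm : MeasurableSet {p : ℝ × ℝ | bulkPoint p.1 p.2 ∈ Q} := measurable_bulkPoint hQ
  have hset : {p : ℝ × ℝ | 0 < p.1 ∧ 0 ≤ p.2 ∧ p.2 < 2 * π ∧ bulkPoint p.1 p.2 ∈ Q} =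
      {p : ℝ × ℝ | bulkPoint p.1 p.2 ∈ Q} ∩ (Ioi 0 ×ˢ Ico 0 (2 * π)) := by
    ext p
    simp only [mem_ofPred_eq, mem_inter_iff, mem_prod, mem_Ioi, mem_Ico]
    tauto
  have hae : Ioi (0 : ℝ) ×ˢ Ico 0 (2 * π) =ᵐ[volume] Ioi (0 : ℝ) ×ˢ Ioc 0 (2 * π) :=
    Measure.set_prod_ae_eq Filter.EventuallyEq.rfl Ico_ae_eq_Ioc
  rw [sliceVolume, hset, ← setLIntegral_indicator hm, setLIntegral_congr hae]
  refine lintegral_congr fun p => ?_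
  by_cases h : bulkPoint p.1 p.2 ∈ Q
  · rw [indicator_of_mem (by exact h), indicator_of_mem h, Pi.one_apply, mul_one]
  · rw [indicator_of_notMem (by exact h), indicator_of_notMem h, mul_zero]

theorem sliceVolume_eq_lintegral_circleSection (L : ℝ) {Q : Set ℂ} (hQ : MeasurableSet Q) :
    sliceVolume L Q = ENNReal.ofReal (L ^ 2) *
      ∫⁻ ρ in Ioi 0, ENNReal.ofReal (Real.sinh ρ) * circleSection Q (Real.tanh ρ) := by
  have : Measurable fun p : ℝ × ℝ => (Q.indicator 1 (bulkPoint p.1 p.2) : ℝ≥0∞) :=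
    (measurable_one.indicator hQ).comp measurable_bulkPoint
  rw [sliceVolume_eq_lintegral_polar L hQ, Measure.volume_eq_prod,
    setLIntegral_prod _ (by fun_prop), ← lintegral_const_mul' _ _ ENNReal.ofReal_ne_top]
  refine setLIntegral_congr_fun measurableSet_Ioi fun ρ _ => ?_
  simp only [ENNReal.ofReal_mul (sq_nonneg L), bulkPoint, circleSection, mul_assoc]
  rw [lintegral_const_mul' _ _ ENNReal.ofReal_ne_top,
    lintegral_const_mul' _ _ ENNReal.ofReal_ne_top]

theorem setLIntegral_chord_mul_croftonDensity (L G d : ℝ) {Q : Set ℂ} (hQ : MeasurableSet Q) :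
    ∫⁻ u in Ioc 0 (2 * π),
        chordLength L Q u (u + d) * ENNReal.ofReal (croftonDensity L G u (u + d)) =
      ENNReal.ofReal L * ENNReal.ofReal (croftonDensity L G 0 d) *
        ∫⁻ s, circleSection Q ‖geodesicPoint 0 d s‖ := by
  have hrot (u s : ℝ) :
      geodesicPoint u (u + d) s = Complex.exp (u * Complex.I) * geodesicPoint 0 d s := by
    rw [← geodesicPoint_add_add, zero_add, add_comm d]
  have hdens (u : ℝ) : croftonDensity L G u (u + d) = croftonDensity L G 0 d := by
    rw [← croftonDensity_add_add L G 0 d u, zero_add, add_comm d]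
  have hm : Measurable fun p : ℝ × ℝ =>
      (Q.indicator 1 (Complex.exp (p.1 * Complex.I) * geodesicPoint 0 d p.2) : ℝ≥0∞) := by
    have hrotm : Measurable fun p : ℝ × ℝ => Complex.exp (p.1 * Complex.I) := by fun_prop
    exact (measurable_one.indicator hQ).comp
      (hrotm.mul ((measurable_geodesicPoint_right 0 d).comp measurable_snd))
  have hcircle (s : ℝ) : ∫⁻ u in Ioc 0 (2 * π),
      Q.indicator 1 (Complex.exp (u * Complex.I) * geodesicPoint 0 d s) =
        circleSection Q ‖geodesicPoint 0 d s‖ := by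
    simpa only [zero_add] using setLIntegral_indicator_exp_mul Q 0 (geodesicPoint 0 d s)
  simp_rw [hdens, chordLength_eq_lintegral L hQ, hrot]
  rw [lintegral_mul_const' _ _ ENNReal.ofReal_ne_top,
    lintegral_const_mul' _ _ ENNReal.ofReal_ne_top, mul_right_comm,
    lintegral_lintegral_swap hm.aemeasurable]
  simp_rw [hcircle]

theorem setLIntegral_Ioo_two_pi_eq_lintegral_arctan (f : ℝ → ℝ≥0∞) :
    ∫⁻ d in Ioo 0 (2 * π), f d =
      ∫⁻ t, ENNReal.ofReal (2 / (1 + t ^ 2)) * f (π - 2 * arctan t) := by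
  have hderiv (t : ℝ) : HasDerivAt (fun t => π - 2 * arctan t) (-(2 / (1 + t ^ 2))) t := by
    convert! ((hasDerivAt_arctan t).const_mul 2).const_sub π using 1
    ring
  have hanti : Antitone fun t => π - 2 * arctan t := fun x y hxy => by
    linarith [arctan_strictMono.monotone hxy]
  have himage : (fun t => π - 2 * arctan t) '' univ = Ioo 0 (2 * π) := by
    refine Subset.antisymm ?_ fun d hd => ⟨Real.tan ((π - d) / 2), mem_univ _, ?_⟩
    · rintro _ ⟨t, -, rfl⟩
      constructor <;> simp only <;> linarith [arctan_lt_pi_div_two t, neg_pi_div_two_lt_arctan t]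
    · simp only
      rw [Real.arctan_tan (by linarith [hd.2]) (by linarith [hd.1])]
      ring
  rw [← himage, lintegral_image_eq_lintegral_deriv_mul_of_antitoneOn MeasurableSet.univ
    (fun t _ => (hderiv t).hasDerivWithinAt) (hanti.antitoneOn _), setLIntegral_univ]
  simp only [neg_neg]

theorem lintegral_eq_lintegral_arsinh_div {a : ℝ} (ha : 0 < a) (f : ℝ → ℝ≥0∞) :
    ∫⁻ s, f s = ∫⁻ y, ENNReal.ofReal (1 / √(a ^ 2 + y ^ 2)) * f (arsinh (y / a)) := by
  have hderiv (y : ℝ) : HasDerivAt (fun y => arsinh (y / a)) (1 / √(a ^ 2 + y ^ 2)) y := by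
    have hsq : a ^ 2 + y ^ 2 = a ^ 2 * (1 + (y / a) ^ 2) := by field_simp
    convert! ((hasDerivAt_id y).div_const a).arsinh using 1
    rw [hsq, Real.sqrt_mul (sq_nonneg a), Real.sqrt_sq ha.le, smul_eq_mul, id]
    field_simp
  have hmono : Monotone fun y => arsinh (y / a) := fun x y hxy =>
    arsinh_strictMono.monotone (by gcongr)
  have himage : (fun y => arsinh (y / a)) '' univ = univ := by
    rw [image_univ, range_eq_univ]
    exact arsinh_surjective.comp fun x => ⟨x * a, mul_div_cancel_right₀ x ha.ne'⟩
  rw [← setLIntegral_univ, ← himage, lintegral_image_eq_lintegral_deriv_mul_of_monotoneOn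
    MeasurableSet.univ (fun y _ => (hderiv y).hasDerivWithinAt) (hmono.monotoneOn _),
    setLIntegral_univ]

theorem setLIntegral_Ioi_eq_lintegral_sinh (f : ℝ → ℝ≥0∞) :
    ∫⁻ r in Ioi 0, f r = ∫⁻ ρ in Ioi 0, ENNReal.ofReal (Real.cosh ρ) * f (Real.sinh ρ) := by
  have himage : Real.sinh '' Ioi 0 = Ioi 0 := by
    ext x
    constructor
    · rintro ⟨y, hy, rfl⟩
      exact Real.sinh_pos_iff.2 hy
    · exact fun hx => ⟨arsinh x, arsinh_pos_iff.2 hx, sinh_arsinh x⟩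
  nth_rewrite 1 [← himage]
  exact lintegral_image_eq_lintegral_deriv_mul_of_monotoneOn measurableSet_Ioi
    (fun ρ _ => (Real.hasDerivAt_sinh ρ).hasDerivWithinAt)
    (Real.sinh_strictMono.monotone.monotoneOn _) f

theorem lintegral_lintegral_sq_add_sq {f : ℝ → ℝ≥0∞} (hf : Measurable f) :
    ∫⁻ x : ℝ, ∫⁻ y : ℝ, f (x ^ 2 + y ^ 2) =
      ENNReal.ofReal (2 * π) * ∫⁻ r in Ioi 0, ENNReal.ofReal r * f (r ^ 2) := by
  have hpolar (p : ℝ × ℝ) : (polarCoord.symm p).1 ^ 2 + (polarCoord.symm p).2 ^ 2 = p.1 ^ 2 := by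
    rw [polarCoord_symm_apply]
    linear_combination p.1 ^ 2 * Real.sin_sq_add_cos_sq p.2
  have h := lintegral_comp_polarCoord_symm fun p : ℝ × ℝ => f (p.1 ^ 2 + p.2 ^ 2)
  rw [Measure.volume_eq_prod, lintegral_prod _ (by fun_prop)] at h
  simp only [← h, hpolar, smul_eq_mul, polarCoord_target]
  rw [setLIntegral_prod _ (by fun_prop)]
  simp only [setLIntegral_const, Real.volume_Ioo, sub_neg_eq_add, ← two_mul]
  rw [lintegral_mul_const _ (by fun_prop), mul_comm]

theorem norm_geodesicPoint_arctan_arsinh (t y : ℝ) :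
    ‖geodesicPoint 0 (π - 2 * arctan t) (arsinh (y / √(1 + t ^ 2)))‖ =
      √((t ^ 2 + y ^ 2) / (1 + (t ^ 2 + y ^ 2))) := by
  have hsq : √(1 + t ^ 2) ^ 2 = 1 + t ^ 2 := Real.sq_sqrt (by positivity)
  have hhalf : (π - 2 * arctan t - 0) / 2 = π / 2 - arctan t := by ring
  rw [norm_geodesicPoint, hhalf, Real.cos_pi_div_two_sub, Real.sin_pi_div_two_sub, tanh_arsinh,
    Real.sin_arctan, Real.cos_arctan]
  simp only [div_pow, one_pow, hsq]
  rw [Real.sq_sqrt (by positivity)]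
  congr 1
  field_simp
  ring

theorem lintegral_circleSection_norm_geodesicPoint (Q : Set ℂ) (t : ℝ) :
    ∫⁻ s, circleSection Q ‖geodesicPoint 0 (π - 2 * arctan t) s‖ =
      ∫⁻ y, ENNReal.ofReal (1 / √(1 + (t ^ 2 + y ^ 2))) *
        circleSection Q √((t ^ 2 + y ^ 2) / (1 + (t ^ 2 + y ^ 2))) := by
  rw [lintegral_eq_lintegral_arsinh_div (Real.sqrt_pos.2 (by positivity : 0 < 1 + t ^ 2))]
  simp only [norm_geodesicPoint_arctan_arsinh]
  rw [Real.sq_sqrt (by positivity)]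
  simp only [add_assoc]

theorem ofReal_jacobian_mul_croftonDensity {L G : ℝ} (hL : 0 ≤ L) (t : ℝ) :
    ENNReal.ofReal (2 / (1 + t ^ 2)) *
        (ENNReal.ofReal L * ENNReal.ofReal (croftonDensity L G 0 (π - 2 * arctan t))) =
      ENNReal.ofReal (L ^ 2 / (4 * G)) := by
  have hhalf : (π - 2 * arctan t - 0) / 2 = π / 2 - arctan t := by ring
  rw [croftonDensity, hhalf, Real.sin_pi_div_two_sub, Real.cos_sq_arctan, ← ENNReal.ofReal_mul hL,
    ← ENNReal.ofReal_mul (by positivity)]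
  congr 1
  field_simp

theorem lintegral_lintegral_circleSection {Q : Set ℂ} (hQ : MeasurableSet Q) :
    ∫⁻ t : ℝ, ∫⁻ y : ℝ, ENNReal.ofReal (1 / √(1 + (t ^ 2 + y ^ 2))) *
        circleSection Q √((t ^ 2 + y ^ 2) / (1 + (t ^ 2 + y ^ 2))) =
      ENNReal.ofReal (2 * π) *
        ∫⁻ ρ in Ioi 0, ENNReal.ofReal (Real.sinh ρ) * circleSection Q (Real.tanh ρ) := by
  have := measurable_circleSection hQ
  rw [lintegral_lintegral_sq_add_sq
    (f := fun q => ENNReal.ofReal (1 / √(1 + q)) * circleSection Q √(q / (1 + q))) (by fun_prop),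
    setLIntegral_Ioi_eq_lintegral_sinh]
  congr 1
  refine setLIntegral_congr_fun measurableSet_Ioi fun ρ hρ => ?_
  have hsinh : 0 < Real.sinh ρ := Real.sinh_pos_iff.2 hρ
  have hcosh : 0 < Real.cosh ρ := Real.cosh_pos ρ
  rw [add_comm 1, ← Real.cosh_sq, Real.sqrt_sq hcosh.le, ← div_pow, Real.sqrt_sq (by positivity),
    ← Real.tanh_eq_sinh_div_cosh, ← mul_assoc, ← mul_assoc, ← ENNReal.ofReal_mul hcosh.le,
    ← ENNReal.ofReal_mul (by positivity)]
  congr 2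
  field_simp

/-- The kinematic space of all oriented geodesics: `kinematicRegion` without the condition of
meeting a region. -/
def kinematicSpace : Set (ℝ × ℝ) :=
  {p | 0 ≤ (p.1 + p.2) / 2 ∧ (p.1 + p.2) / 2 < 2 * π ∧ 0 < (p.2 - p.1) / 2 ∧ (p.2 - p.1) / 2 < π}

theorem measurableSet_kinematicSpace : MeasurableSet kinematicSpace := by
  have hθ : Measurable fun p : ℝ × ℝ => (p.1 + p.2) / 2 := by fun_prop
  have hα : Measurable fun p : ℝ × ℝ => (p.2 - p.1) / 2 := by fun_prop
  exact (measurableSet_le measurable_const hθ).inter ((measurableSet_lt hθ measurable_const).inter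
    ((measurableSet_lt measurable_const hα).inter (measurableSet_lt hα measurable_const)))

theorem mem_kinematicSpace_add_iff {u d : ℝ} :
    (u, u + d) ∈ kinematicSpace ↔
      d ∈ Ioo 0 (2 * π) ∧ u ∈ Ico (-(d / 2)) (-(d / 2) + 2 * π) := by
  simp only [kinematicSpace, mem_ofPred_eq, mem_Ioo, mem_Ico]
  constructor
  · rintro ⟨_, _, _, _⟩
    refine ⟨⟨?_, ?_⟩, ?_, ?_⟩ <;> linarith
  · rintro ⟨⟨_, _⟩, _, _⟩
    refine ⟨?_, ?_, ?_, ?_⟩ <;> linarith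

theorem setLIntegral_kinematicSpace {f : ℝ → ℝ → ℝ≥0∞} (hf : Measurable (Function.uncurry f))
    (hper : ∀ u v, f (u + 2 * π) (v + 2 * π) = f u v) (c : ℝ) :
    ∫⁻ p in kinematicSpace, f p.1 p.2 =
      ∫⁻ d in Ioo 0 (2 * π), ∫⁻ u in Ioc c (c + 2 * π), f u (u + d) := by
  set F := kinematicSpace.indicator fun p : ℝ × ℝ => f p.1 p.2 with hF
  have hFm : Measurable F := Measurable.indicator hf measurableSet_kinematicSpace
  have hslice (d : ℝ) : ∫⁻ u, F (u, u + d) =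
      (Ioo 0 (2 * π)).indicator (fun d => ∫⁻ u in Ioc c (c + 2 * π), f u (u + d)) d := by
    by_cases hd : d ∈ Ioo 0 (2 * π)
    · have hfd : Function.Periodic (fun u => f u (u + d)) (2 * π) := fun u => by
        simp only [add_right_comm u (2 * π) d, hper]
      rw [indicator_of_mem hd, setLIntegral_Ioc_add_eq_of_periodic two_pi_pos hfd c (-(d / 2)),
        ← setLIntegral_congr Ico_ae_eq_Ioc, ← lintegral_indicator measurableSet_Ico]
      simp only [hF, indicator, mem_kinematicSpace_add_iff, hd, true_and]
    · simp [hF, indicator, mem_kinematicSpace_add_iff, hd]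
  calc ∫⁻ p in kinematicSpace, f p.1 p.2 = ∫⁻ u, ∫⁻ v, F (u, v) := by
        rw [← lintegral_indicator measurableSet_kinematicSpace, Measure.volume_eq_prod,
          lintegral_prod _ hFm.aemeasurable]
    _ = ∫⁻ u, ∫⁻ d, F (u, u + d) := by
        refine lintegral_congr fun u => ?_
        rw [lintegral_add_left_eq_self fun v => F (u, v)]
    _ = ∫⁻ d, ∫⁻ u, F (u, u + d) :=
        lintegral_lintegral_swap (f := fun u d => F (u, u + d)) (by fun_prop)
    _ = ∫⁻ d in Ioo 0 (2 * π), ∫⁻ u in Ioc c (c + 2 * π), f u (u + d) := by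
        simp only [hslice, lintegral_indicator measurableSet_Ioo]

theorem chordLength_add_two_pi_add_two_pi (L : ℝ) (Q : Set ℂ) (u v : ℝ) :
    chordLength L Q (u + 2 * π) (v + 2 * π) = chordLength L Q u v := by
  have hexp : Complex.exp ((2 * π : ℝ) * Complex.I) = 1 := by simp
  simp only [chordLength, geodesicPoint_add_add, hexp, one_mul]

-- In the coordinates `t = cot (d / 2)` and `y = √(1 + t²) sinh s` the Crofton density becomes flat,
-- and the circle reached at `(t, y)` has radius `tanh ρ` with `sinh² ρ = t² + y²`.
theorem setLIntegral_kinematicSpace_chordLength {Q : Set ℂ} (hQ : MeasurableSet Q) {L G : ℝ}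
    (hL : 0 ≤ L) (hG : 0 < G) :
    ∫⁻ p in kinematicSpace,
        chordLength L Q p.1 p.2 * ENNReal.ofReal (croftonDensity L G p.1 p.2) =
      ENNReal.ofReal (π / (2 * G)) * sliceVolume L Q := by
  rw [setLIntegral_kinematicSpace
    (f := fun u v => chordLength L Q u v * ENNReal.ofReal (croftonDensity L G u v))
    ((measurable_chordLength L hQ).mul (measurable_croftonDensity L G).ennreal_ofReal)
    (fun u v => by simp only [chordLength_add_two_pi_add_two_pi, croftonDensity_add_add]) 0]
  simp only [zero_add, setLIntegral_chord_mul_croftonDensity L G _ hQ]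
  rw [setLIntegral_Ioo_two_pi_eq_lintegral_arctan]
  simp only [← mul_assoc _ _ (∫⁻ _, _), ofReal_jacobian_mul_croftonDensity hL,
    lintegral_circleSection_norm_geodesicPoint]
  rw [lintegral_const_mul' _ _ ENNReal.ofReal_ne_top, lintegral_lintegral_circleSection hQ,
    sliceVolume_eq_lintegral_circleSection L hQ, ← mul_assoc, ← mul_assoc,
    ← ENNReal.ofReal_mul (by positivity), ← ENNReal.ofReal_mul (by positivity)]
  congr 2
  field_simp
  ring

theorem kinematicRegion_eq_inter (Q : Set ℂ) :
    kinematicRegion Q = {p | ∃ s, geodesicPoint p.1 p.2 s ∈ Q} ∩ kinematicSpace := by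
  ext p
  simp only [kinematicRegion, kinematicSpace, mem_inter_iff, mem_ofPred_eq]
  tauto

theorem support_chordLength_subset (L : ℝ) (Q : Set ℂ) :
    (Function.support fun p : ℝ × ℝ => chordLength L Q p.1 p.2) ⊆
      {p | ∃ s, geodesicPoint p.1 p.2 s ∈ Q} := by
  intro p hp
  by_contra hempty
  have hempty : ∀ s, geodesicPoint p.1 p.2 s ∉ Q := by simpa using hempty
  exact hp (by simp [chordLength, hempty])

theorem setLIntegral_kinematicRegion {Q : Set ℂ} (hQ : MeasurableSet Q) {L G ε : ℝ}
    (hL : 0 ≤ L) (hG : 0 < G) (hε : 0 < ε) :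
    ∫⁻ p in kinematicRegion Q, chordLength L Q p.1 p.2 * ENNReal.ofReal (crofton L G ε p.1 p.2) =
      ENNReal.ofReal (π / (2 * G)) * sliceVolume L Q := by
  rw [kinematicRegion_eq_inter, ← Measure.restrict_restrict' measurableSet_kinematicSpace,
    setLIntegral_eq_of_support_subset
      ((Function.support_mul_subset_left _ _).trans (support_chordLength_subset L Q)),
    ← setLIntegral_kinematicSpace_chordLength hQ hL hG]
  refine setLIntegral_congr_fun measurableSet_kinematicSpace ?_
  rintro p ⟨-, -, hα, hα'⟩
  simp only [crofton_eq_croftonDensity L G hε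
    (sin_half_sub_pos (by linarith : p.1 < p.2) (by linarith)).ne']

/-! ### Interval regions and ideal polygons -/

theorem tanh_le_iff {ρ x : ℝ} (hx : x ∈ Ioo (-1) 1) : Real.tanh ρ ≤ x ↔ ρ ≤ artanh x := by
  nth_rewrite 2 [← artanh_tanh ρ]
  rw [artanh_le_artanh_iff ⟨Real.neg_one_lt_tanh ρ, Real.tanh_lt_one ρ⟩ hx]

theorem le_tanh_iff {ρ x : ℝ} (hx : x ∈ Ioo (-1) 1) : x ≤ Real.tanh ρ ↔ artanh x ≤ ρ := by
  nth_rewrite 2 [← artanh_tanh ρ]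
  rw [artanh_le_artanh_iff hx ⟨Real.neg_one_lt_tanh ρ, Real.tanh_lt_one ρ⟩]

theorem tanh_nonneg {ρ : ℝ} (hρ : 0 ≤ ρ) : 0 ≤ Real.tanh ρ := by
  rw [Real.tanh_eq_sinh_div_cosh]
  exact div_nonneg (Real.sinh_nonneg_iff.2 hρ) (Real.cosh_pos ρ).le

theorem cos_half_sub_nonneg {u v : ℝ} (huv : u ≤ v) (hv : v ≤ u + π) :
    0 ≤ Real.cos ((v - u) / 2) :=
  Real.cos_nonneg_of_mem_Icc ⟨by linarith [pi_pos], by linarith⟩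

theorem cos_half_lt_cos_sub {u v χ : ℝ} (hv : v ≤ u + 2 * π) (hχ : χ ∈ Ioo u v) :
    Real.cos ((v - u) / 2) < Real.cos (χ - (u + v) / 2) := by
  rw [← Real.cos_abs (χ - (u + v) / 2)]
  exact Real.cos_lt_cos_of_nonneg_of_le_pi (abs_nonneg _) (by linarith)
    (abs_lt.2 ⟨by linarith [hχ.1], by linarith [hχ.2]⟩)

theorem cos_sub_lt_cos_half {u v χ : ℝ} (huv : u ≤ v) (hχ : χ ∈ Ioo v (u + 2 * π)) :
    Real.cos (χ - (u + v) / 2) < Real.cos ((v - u) / 2) := by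
  have h := cos_half_lt_cos_sub (by linarith) hχ
  have hhalf : (u + 2 * π - v) / 2 = π - (v - u) / 2 := by ring
  have hmid : χ - (v + (u + 2 * π)) / 2 = χ - (u + v) / 2 - π := by ring
  rw [hhalf, hmid, Real.cos_pi_sub, Real.cos_sub_pi] at h
  linarith

theorem norm_bulkPoint_lt_one (ρ χ : ℝ) : ‖bulkPoint ρ χ‖ < 1 := by
  rw [bulkPoint, norm_mul, Complex.norm_exp_ofReal_mul_I, mul_one, Complex.norm_real,
    Real.norm_eq_abs]
  exact Real.abs_tanh_lt_one ρ

theorem bulkPoint_mem_intervalRegion {ρ χ u v : ℝ} :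
    bulkPoint ρ χ ∈ intervalRegion u v ↔
      Real.cos ((v - u) / 2) < Real.tanh ρ * Real.cos (χ - (u + v) / 2) := by
  have hrot : bulkPoint ρ χ * Complex.exp (-((u + v) / 2 : ℝ) * Complex.I) =
      (Real.tanh ρ : ℂ) * Complex.exp ((χ - (u + v) / 2 : ℝ) * Complex.I) := by
    rw [bulkPoint, mul_assoc, ← Complex.exp_add]
    congr 2
    push_cast
    ring
  simp only [intervalRegion, mem_ofPred_eq, norm_bulkPoint_lt_one, true_and]
  rw [hrot, Complex.re_ofReal_mul, Complex.exp_ofReal_mul_I_re]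

theorem bulkPoint_notMem_intervalRegion {ρ χ u v : ℝ} (hρ : 0 ≤ ρ) (huv : u ≤ v)
    (hv : v ≤ u + π) (h : Real.cos (χ - (u + v) / 2) ≤ Real.cos ((v - u) / 2)) :
    bulkPoint ρ χ ∉ intervalRegion u v := by
  rw [bulkPoint_mem_intervalRegion, not_lt]
  calc Real.tanh ρ * Real.cos (χ - (u + v) / 2)
      ≤ Real.tanh ρ * Real.cos ((v - u) / 2) := mul_le_mul_of_nonneg_left h (tanh_nonneg hρ)
    _ ≤ Real.cos ((v - u) / 2) :=
        mul_le_of_le_one_left (cos_half_sub_nonneg huv hv) (Real.tanh_lt_one ρ).le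

theorem bulkPoint_mem_intervalRegion_of_pi_lt {ρ χ u v : ℝ} (huv : u + π < v)
    (hv : v ≤ u + 2 * π) (hχ : χ ∈ Ioo u v) (hρ : 0 ≤ ρ) :
    bulkPoint ρ χ ∈ intervalRegion u v := by
  have hneg : Real.cos ((v - u) / 2) < 0 :=
    Real.cos_neg_of_pi_div_two_lt_of_lt (by linarith) (by linarith [pi_pos])
  rw [bulkPoint_mem_intervalRegion]
  nlinarith [tanh_nonneg hρ, Real.tanh_lt_one ρ, cos_half_lt_cos_sub hv hχ]

theorem measurableSet_intervalRegion (u v : ℝ) : MeasurableSet (intervalRegion u v) :=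
  (measurableSet_lt measurable_norm measurable_const).inter
    (measurableSet_lt measurable_const (Complex.measurable_re.comp (by fun_prop)))

theorem exp_mul_mem_intervalRegion_iff {z : ℂ} (c u v : ℝ) :
    Complex.exp (c * Complex.I) * z ∈ intervalRegion (u + c) (v + c) ↔ z ∈ intervalRegion u v := by
  have hmid : (u + c + (v + c)) / 2 = c + (u + v) / 2 := by ring
  have hrot : Complex.exp (c * Complex.I) * z *
      Complex.exp (-((u + c + (v + c)) / 2 : ℝ) * Complex.I) =
        z * Complex.exp (-((u + v) / 2 : ℝ) * Complex.I) := by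
    rw [hmid, mul_right_comm, ← Complex.exp_add, mul_comm, Complex.ofReal_add]
    ring_nf
  simp only [intervalRegion, mem_ofPred_eq, norm_mul, Complex.norm_exp_ofReal_mul_I, one_mul,
    add_sub_add_right_eq_sub, hrot]

theorem intervalRegion_add_two_pi (u v : ℝ) :
    intervalRegion (u + 2 * π) (v + 2 * π) = intervalRegion u v := by
  ext z
  simpa using exp_mul_mem_intervalRegion_iff (z := z) (2 * π) u v

/-- The ideal polygon whose successive vertices are the boundary points at the angles `x i`: what
remains of the slice after removing the regions cut off by its sides. Going round the circle
repeats the vertices, so the vertices of an ideal `n`-gon are indexed by `ℕ`; see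
`IsVertexSequence`. -/
def idealPolygon (x : ℕ → ℝ) : Set ℂ :=
  {z | ‖z‖ < 1 ∧ ∀ i, z ∉ intervalRegion (x i) (x (i + 1))}

/-- The angles `x i` are those of the vertices of an ideal `n`-gon, met successively when going
round the circle any number of times. -/
structure IsVertexSequence (n : ℕ) (x : ℕ → ℝ) : Prop where
  strictMono : StrictMono x
  add_period : ∀ i, x (i + n) = x i + 2 * π

theorem measurableSet_idealPolygon (x : ℕ → ℝ) : MeasurableSet (idealPolygon x) :=
  (measurableSet_lt measurable_norm measurable_const).inter
    (measurableSet_setOfPred.2 (Measurable.forall fun _ =>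
      measurableSet_setOfPred.1 (measurableSet_intervalRegion _ _).compl))

theorem exp_mul_mem_idealPolygon_iff {z : ℂ} (c : ℝ) (x : ℕ → ℝ) :
    Complex.exp (c * Complex.I) * z ∈ idealPolygon (fun i => x i + c) ↔ z ∈ idealPolygon x := by
  simp only [idealPolygon, mem_ofPred_eq, norm_mul, Complex.norm_exp_ofReal_mul_I, one_mul,
    exp_mul_mem_intervalRegion_iff]

namespace IsVertexSequence

variable {n : ℕ} {x : ℕ → ℝ}

theorem intervalRegion_periodic (hx : IsVertexSequence n x) :
    Function.Periodic (fun i => intervalRegion (x i) (x (i + 1))) n := fun i => by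
  simp only [add_right_comm i n 1, hx.add_period, intervalRegion_add_two_pi]

theorem pos (hx : IsVertexSequence n x) : 0 < n := by
  refine Nat.pos_of_ne_zero fun hn => ?_
  have h := hx.add_period 0
  rw [hn] at h
  linarith [pi_pos]

theorem mem_idealPolygon_iff (hx : IsVertexSequence n x) {z : ℂ} :
    z ∈ idealPolygon x ↔ ‖z‖ < 1 ∧ ∀ i < n, z ∉ intervalRegion (x i) (x (i + 1)) := by
  refine and_congr_right fun _ => ⟨fun h i _ => h i, fun h i => ?_⟩
  rw [← hx.intervalRegion_periodic.map_mod_nat i]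
  exact h _ (i.mod_lt hx.pos)

theorem comp_add (hx : IsVertexSequence n x) (k : ℕ) : IsVertexSequence n fun i => x (i + k) where
  strictMono := hx.strictMono.comp fun _ _ h => Nat.add_lt_add_right h k
  add_period i := by rw [add_right_comm, hx.add_period]

theorem idealPolygon_comp_add (hx : IsVertexSequence n x) (k : ℕ) :
    idealPolygon (fun i => x (i + k)) = idealPolygon x := by
  ext z
  refine and_congr_right fun _ => ⟨fun h i => ?_, fun h i => ?_⟩
  · have hle : k ≤ i + k * n := le_add_left (Nat.le_mul_of_pos_right k hx.pos)
    have hper := hx.intervalRegion_periodic.nat_mul k i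
    simp only [Nat.cast_id] at hper
    rw [← hper]
    simpa only [add_right_comm _ 1 k, Nat.sub_add_cancel hle] using h (i + k * n - k)
  · simpa only [add_right_comm i 1 k] using h (i + k)

theorem le_add_two_pi (hx : IsVertexSequence n x) {i k : ℕ} (hi : i < n) :
    x (i + 1) ≤ x k + 2 * π := by
  rw [← hx.add_period]
  exact hx.strictMono.monotone (by omega)

theorem cos_sub_lt_cos_half (hx : IsVertexSequence n x) {i k : ℕ} (hi : i < n) (hk : k < n)
    (hne : k ≠ i) {χ : ℝ} (hχ : χ ∈ Ioo (x i) (x (i + 1))) :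
    Real.cos (χ - (x k + x (k + 1)) / 2) < Real.cos ((x (k + 1) - x k) / 2) := by
  have hside : x k ≤ x (k + 1) := (hx.strictMono k.lt_succ_self).le
  rcases hne.lt_or_gt with hki | hik
  · have hle : x (k + 1) ≤ x i := hx.strictMono.monotone hki
    exact _root_.cos_sub_lt_cos_half hside
      ⟨hle.trans_lt hχ.1, hχ.2.trans_le (hx.le_add_two_pi hi)⟩
  · have hle : x (i + 1) ≤ x k := hx.strictMono.monotone hik
    have h := _root_.cos_sub_lt_cos_half (χ := χ + 2 * π) hside
      ⟨(hx.le_add_two_pi (k := i) hk).trans_lt (by linarith [hχ.1]), by linarith [hχ.2]⟩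
    rwa [add_sub_right_comm, Real.cos_add_two_pi] at h

theorem bulkPoint_mem_idealPolygon_iff (hx : IsVertexSequence n x) {i : ℕ} (hi : i < n) {ρ χ : ℝ}
    (hρ : 0 ≤ ρ) (hχ : χ ∈ Ioo (x i) (x (i + 1))) :
    bulkPoint ρ χ ∈ idealPolygon x ↔
      ∀ k < n, k = i ∨ x k + π < x (k + 1) → bulkPoint ρ χ ∉ intervalRegion (x k) (x (k + 1)) := by
  simp only [hx.mem_idealPolygon_iff, norm_bulkPoint_lt_one, true_and]
  refine forall₂_congr fun k hk => ⟨fun h _ => h, fun h => ?_⟩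
  by_cases hfacing : k = i ∨ x k + π < x (k + 1)
  · exact h hfacing
  · rw [not_or, not_lt] at hfacing
    exact bulkPoint_notMem_intervalRegion hρ (hx.strictMono k.lt_succ_self).le hfacing.2
      (hx.cos_sub_lt_cos_half hi hk hfacing.1 hχ).le

end IsVertexSequence

/-! ### The volume of an ideal polygon -/

/-- The volume per unit angle of `Q` in the direction `χ`, for `L = 1`. -/
noncomputable def radialVolume (Q : Set ℂ) (χ : ℝ) : ℝ≥0∞ :=
  ∫⁻ ρ in Ioi 0, ENNReal.ofReal (Real.sinh ρ) * Q.indicator 1 (bulkPoint ρ χ)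

theorem radialVolume_periodic (Q : Set ℂ) : Function.Periodic (radialVolume Q) (2 * π) :=
  fun χ => by simp only [radialVolume, bulkPoint, periodic_exp_ofReal_mul_I χ]

theorem sliceVolume_eq_lintegral_radialVolume (L : ℝ) {Q : Set ℂ} (hQ : MeasurableSet Q) (c : ℝ) :
    sliceVolume L Q = ENNReal.ofReal (L ^ 2) * ∫⁻ χ in Ioc c (c + 2 * π), radialVolume Q χ := by
  have : Measurable fun p : ℝ × ℝ => (Q.indicator 1 (bulkPoint p.1 p.2) : ℝ≥0∞) :=
    (measurable_one.indicator hQ).comp measurable_bulkPoint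
  rw [setLIntegral_Ioc_add_eq_of_periodic two_pi_pos (radialVolume_periodic Q) c 0, zero_add,
    sliceVolume_eq_lintegral_polar L hQ, Measure.volume_eq_prod,
    setLIntegral_prod_symm _ (by fun_prop), ← lintegral_const_mul' _ _ ENNReal.ofReal_ne_top]
  refine lintegral_congr fun χ => ?_
  rw [radialVolume, ← lintegral_const_mul' _ _ ENNReal.ofReal_ne_top]
  simp only [ENNReal.ofReal_mul (sq_nonneg L), mul_assoc]

theorem setLIntegral_sinh {a b : ℝ} (ha : 0 ≤ a) (hab : a ≤ b) :
    ∫⁻ ρ in Ioc a b, ENNReal.ofReal (Real.sinh ρ) =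
      ENNReal.ofReal (Real.cosh b - Real.cosh a) := by
  have hi : IntervalIntegrable Real.sinh volume a b := Real.continuous_sinh.intervalIntegrable a b
  rw [← ofReal_integral_eq_lintegral_ofReal hi.1 ((ae_restrict_iff' measurableSet_Ioc).2
      (.of_forall fun ρ hρ => Real.sinh_nonneg_iff.2 (ha.trans hρ.1.le))),
    ← intervalIntegral.integral_of_le hab,
    intervalIntegral.integral_eq_sub_of_hasDerivAt (fun x _ => Real.hasDerivAt_cosh x) hi]

theorem radialVolume_of_forall_mem_iff {Q : Set ℂ} {χ a b : ℝ} (ha : 0 ≤ a) (hab : a ≤ b)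
    (h : ∀ ρ, 0 < ρ → (bulkPoint ρ χ ∈ Q ↔ a ≤ ρ ∧ ρ ≤ b)) :
    radialVolume Q χ = ENNReal.ofReal (Real.cosh b - Real.cosh a) := by
  have hsection : ∀ ρ ∈ Ioi (0 : ℝ),
      ENNReal.ofReal (Real.sinh ρ) * Q.indicator 1 (bulkPoint ρ χ) =
        (Icc a b).indicator (fun ρ => ENNReal.ofReal (Real.sinh ρ)) ρ := fun ρ hρ => by
    by_cases hmem : ρ ∈ Icc a b
    · rw [indicator_of_mem ((h ρ hρ).2 hmem), indicator_of_mem hmem, Pi.one_apply, mul_one]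
    · rw [indicator_of_notMem (mt (h ρ hρ).1 hmem), indicator_of_notMem hmem, mul_zero]
  have hpos : Ioc a b ∩ Ioi 0 = Ioc a b := inter_eq_left.2 fun ρ hρ => ha.trans_lt hρ.1
  rw [radialVolume, setLIntegral_congr_fun measurableSet_Ioi hsection,
    setLIntegral_indicator measurableSet_Icc,
    ← setLIntegral_congr (Ioc_ae_eq_Icc.inter (Filter.EventuallyEq.refl _ (Ioi 0))), hpos,
    setLIntegral_sinh ha hab]

theorem ae_restrict_Ioc_mem_Ioo (u v : ℝ) : ∀ᵐ χ ∂volume.restrict (Ioc u v), χ ∈ Ioo u v := by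
  rw [← restrict_Ioo_eq_restrict_Ioc]
  exact ae_restrict_mem measurableSet_Ioo

/-- The radial coordinate `ρ` of the point of the geodesic `(u, v)` in the direction `χ`. It is
meaningful for `χ` in `(u, v)` when `v ≤ u + π`. -/
noncomputable def geodesicRadius (u v χ : ℝ) : ℝ :=
  artanh (Real.cos ((v - u) / 2) / Real.cos (χ - (u + v) / 2))

section geodesicRadius

variable {u v χ ρ : ℝ}

theorem measurable_geodesicRadius (u v : ℝ) : Measurable (geodesicRadius u v) := by
  unfold geodesicRadius artanh
  fun_prop

theorem cos_sub_pos (huv : u ≤ v) (hv : v ≤ u + π) (hχ : χ ∈ Ioo u v) :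
    0 < Real.cos (χ - (u + v) / 2) :=
  (cos_half_sub_nonneg huv hv).trans_lt (cos_half_lt_cos_sub (by linarith [pi_pos]) hχ)

theorem cos_half_div_cos_sub_mem_Ico (hv : v ≤ u + π) (hχ : χ ∈ Ioo u v) :
    Real.cos ((v - u) / 2) / Real.cos (χ - (u + v) / 2) ∈ Ico 0 1 :=
  have huv : u ≤ v := (hχ.1.trans hχ.2).le
  have hpos := cos_sub_pos huv hv hχ
  ⟨div_nonneg (cos_half_sub_nonneg huv hv) hpos.le,
    (div_lt_one hpos).2 (cos_half_lt_cos_sub (by linarith [pi_pos]) hχ)⟩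

theorem geodesicRadius_nonneg (hv : v ≤ u + π) (hχ : χ ∈ Ioo u v) : 0 ≤ geodesicRadius u v χ :=
  artanh_nonneg (cos_half_div_cos_sub_mem_Ico hv hχ).1

theorem bulkPoint_notMem_intervalRegion_iff (hv : v ≤ u + π) (hχ : χ ∈ Ioo u v) :
    bulkPoint ρ χ ∉ intervalRegion u v ↔ ρ ≤ geodesicRadius u v χ := by
  have hmem := cos_half_div_cos_sub_mem_Ico hv hχ
  rw [bulkPoint_mem_intervalRegion, not_lt, geodesicRadius,
    ← tanh_le_iff ⟨neg_one_lt_zero.trans_le hmem.1, hmem.2⟩,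
    le_div_iff₀ (cos_sub_pos (hχ.1.trans hχ.2).le hv hχ)]

theorem bulkPoint_notMem_intervalRegion_add_two_pi_iff (hv : v ≤ u + π) (hχ : χ ∈ Ioo u v) :
    bulkPoint ρ χ ∉ intervalRegion v (u + 2 * π) ↔ geodesicRadius u v χ ≤ ρ := by
  have hmem := cos_half_div_cos_sub_mem_Ico hv hχ
  have hhalf : (u + 2 * π - v) / 2 = π - (v - u) / 2 := by ring
  have hmid : χ - (v + (u + 2 * π)) / 2 = χ - (u + v) / 2 - π := by ring
  rw [bulkPoint_mem_intervalRegion, hhalf, hmid, Real.cos_pi_sub, Real.cos_sub_pi, mul_neg,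
    neg_lt_neg_iff, not_lt, geodesicRadius,
    ← le_tanh_iff ⟨neg_one_lt_zero.trans_le hmem.1, hmem.2⟩,
    div_le_iff₀ (cos_sub_pos (hχ.1.trans hχ.2).le hv hχ)]

theorem cos_half_mul_cos_sub_le {U V : ℝ} (hU : U ≤ u) (hV : v ≤ V) (hUV : V ≤ U + π)
    (hχ : χ ∈ Ioo u v) :
    Real.cos ((V - U) / 2) * Real.cos (χ - (u + v) / 2) ≤
      Real.cos ((v - u) / 2) * Real.cos (χ - (U + V) / 2) := by
  obtain ⟨hu, hv⟩ := hχ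
  have hhalf (a b : ℝ) : (b - a) / 2 = (χ - a) / 2 + (b - χ) / 2 := by ring
  have hmid (a b : ℝ) : χ - (a + b) / 2 = (χ - a) / 2 - (b - χ) / 2 := by ring
  have hcos {x y : ℝ} (hx : 0 ≤ x) (hxy : x ≤ y) (hy : y ≤ π / 2) :
      0 ≤ Real.cos y ∧ Real.cos y ≤ Real.cos x :=
    ⟨Real.cos_nonneg_of_mem_Icc ⟨by linarith, hy⟩,
      Real.cos_le_cos_of_nonneg_of_le_pi hx (by linarith) hxy⟩
  have hsin {x y : ℝ} (hx : 0 ≤ x) (hxy : x ≤ y) (hy : y ≤ π / 2) :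
      0 ≤ Real.sin x ∧ Real.sin x ≤ Real.sin y :=
    ⟨Real.sin_nonneg_of_nonneg_of_le_pi hx (by linarith),
      Real.sin_le_sin_of_le_of_le_pi_div_two (by linarith) hy hxy⟩
  obtain ⟨hcU, hcU'⟩ := hcos (x := (χ - u) / 2) (y := (χ - U) / 2)
    (by linarith) (by linarith) (by linarith)
  obtain ⟨hcV, hcV'⟩ := hcos (x := (v - χ) / 2) (y := (V - χ) / 2)
    (by linarith) (by linarith) (by linarith)
  obtain ⟨hsu, hsu'⟩ := hsin (x := (χ - u) / 2) (y := (χ - U) / 2)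
    (by linarith) (by linarith) (by linarith)
  obtain ⟨hsv, hsv'⟩ := hsin (x := (v - χ) / 2) (y := (V - χ) / 2)
    (by linarith) (by linarith) (by linarith)
  have hcc := mul_le_mul hcU' hcV' hcV (hcU.trans hcU')
  have hss := mul_le_mul hsu' hsv' hsv (hsu.trans hsu')
  have hprod := mul_le_mul hcc hss (mul_nonneg hsu hsv) ((mul_nonneg hcU hcV).trans hcc)
  rw [hhalf U, hhalf u, hmid u, hmid U, Real.cos_add, Real.cos_sub, Real.cos_add, Real.cos_sub]
  linarith

theorem geodesicRadius_le_geodesicRadius {U V : ℝ} (hU : U ≤ u) (hV : v ≤ V) (hUV : V ≤ U + π)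
    (hχ : χ ∈ Ioo u v) : geodesicRadius U V χ ≤ geodesicRadius u v χ := by
  have hv : v ≤ u + π := by linarith
  have hχ' : χ ∈ Ioo U V := Ioo_subset_Ioo hU hV hχ
  have hmem := cos_half_div_cos_sub_mem_Ico hv hχ
  have hmem' := cos_half_div_cos_sub_mem_Ico hUV hχ'
  have hneg {x : ℝ} (hx : x ∈ Ico (0 : ℝ) 1) : x ∈ Ioo (-1) 1 :=
    ⟨neg_one_lt_zero.trans_le hx.1, hx.2⟩
  rw [geodesicRadius, geodesicRadius, artanh_le_artanh_iff (hneg hmem') (hneg hmem),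
    div_le_div_iff₀ (cos_sub_pos (hχ'.1.trans hχ'.2).le hUV hχ')
      (cos_sub_pos (hχ.1.trans hχ.2).le hv hχ)]
  exact cos_half_mul_cos_sub_le hU hV hUV hχ

theorem cosh_artanh_div {k c : ℝ} (hk : 0 ≤ k) (hkc : k < c) :
    Real.cosh (artanh (k / c)) = c / √(c ^ 2 - k ^ 2) := by
  have hc : 0 < c := hk.trans_lt hkc
  have hsq : 1 - (k / c) ^ 2 = (c ^ 2 - k ^ 2) / c ^ 2 := by field_simp
  rw [cosh_artanh ⟨neg_one_lt_zero.trans_le (by positivity), (div_lt_one hc).2 hkc⟩, hsq,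
    Real.sqrt_div' _ (sq_nonneg c), Real.sqrt_sq hc.le, one_div_div]

theorem hasDerivAt_arcsin_sin_sub_div_sin {α θ : ℝ} (hα : 0 < Real.sin α)
    (h : Real.cos α ^ 2 < Real.cos (χ - θ) ^ 2) :
    HasDerivAt (fun χ => arcsin (Real.sin (χ - θ) / Real.sin α))
      (Real.cos (χ - θ) / √(Real.cos (χ - θ) ^ 2 - Real.cos α ^ 2)) χ := by
  have hsq : 1 - (Real.sin (χ - θ) / Real.sin α) ^ 2 =
      (Real.cos (χ - θ) ^ 2 - Real.cos α ^ 2) / Real.sin α ^ 2 := by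
    rw [Real.cos_sq', Real.cos_sq']
    field_simp
    ring
  have hpos : 0 < 1 - (Real.sin (χ - θ) / Real.sin α) ^ 2 :=
    hsq ▸ div_pos (sub_pos.2 h) (by positivity)
  have hne_neg_one : Real.sin (χ - θ) / Real.sin α ≠ -1 := fun h => by norm_num [h] at hpos
  have hne_one : Real.sin (χ - θ) / Real.sin α ≠ 1 := fun h => by norm_num [h] at hpos
  convert! (hasDerivAt_arcsin hne_neg_one hne_one).comp χ
    (((hasDerivAt_id χ).sub_const θ).sin.div_const (Real.sin α)) using 1
  rw [id, hsq, Real.sqrt_div' _ (sq_nonneg _), Real.sqrt_sq hα.le]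
  field_simp

theorem setLIntegral_cosh_geodesicRadius (huv : u < v) (hv : v ≤ u + π) :
    ∫⁻ χ in Ioc u v, ENNReal.ofReal (Real.cosh (geodesicRadius u v χ)) = ENNReal.ofReal π := by
  have hsin := sin_half_sub_pos huv (by linarith [pi_pos])
  have hcont : ContinuousOn
      (fun χ => arcsin (Real.sin (χ - (u + v) / 2) / Real.sin ((v - u) / 2))) (Icc u v) :=
    Continuous.continuousOn (by fun_prop)
  have hderiv : ∀ χ ∈ Ioo u v, HasDerivAt _ (Real.cosh (geodesicRadius u v χ)) χ :=
    fun χ hχ => by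
      have hlt := cos_half_lt_cos_sub (by linarith [pi_pos]) hχ
      have hnonneg := cos_half_sub_nonneg huv.le hv
      rw [geodesicRadius, cosh_artanh_div hnonneg hlt]
      exact hasDerivAt_arcsin_sin_sub_div_sin hsin (pow_lt_pow_left₀ hlt hnonneg two_ne_zero)
  have hint := intervalIntegral.integrableOn_deriv_of_nonneg hcont hderiv
    fun χ _ => (Real.cosh_pos _).le
  have hright : v - (u + v) / 2 = (v - u) / 2 := by ring
  have hleft : u - (u + v) / 2 = -((v - u) / 2) := by ring
  rw [← ofReal_integral_eq_lintegral_ofReal hint (.of_forall fun χ => (Real.cosh_pos _).le),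
    ← intervalIntegral.integral_of_le huv.le,
    intervalIntegral.integral_eq_sub_of_hasDerivAt_of_le huv.le hcont hderiv
      ((intervalIntegrable_iff_integrableOn_Ioc_of_le huv.le).2 hint),
    hright, hleft, Real.sin_neg, neg_div, div_self hsin.ne', arcsin_neg, arcsin_one, sub_neg_eq_add,
    add_halves]

end geodesicRadius

theorem setLIntegral_radialVolume_add {Q : Set ℂ} {u v : ℝ} (huv : u < v) (hv : v ≤ u + π)
    {a : ℝ → ℝ} (ha : Measurable a)
    (hle : ∀ χ ∈ Ioo u v, 0 ≤ a χ ∧ a χ ≤ geodesicRadius u v χ)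
    (hQ : ∀ χ ∈ Ioo u v, ∀ ρ, 0 < ρ →
      (bulkPoint ρ χ ∈ Q ↔ a χ ≤ ρ ∧ ρ ≤ geodesicRadius u v χ)) :
    (∫⁻ χ in Ioc u v, radialVolume Q χ) + ∫⁻ χ in Ioc u v, ENNReal.ofReal (Real.cosh (a χ)) =
      ENNReal.ofReal π := by
  have hcosh : Measurable fun χ => ENNReal.ofReal (Real.cosh (a χ)) := by fun_prop
  rw [← setLIntegral_cosh_geodesicRadius huv hv, ← lintegral_add_right _ hcosh]
  refine lintegral_congr_ae ((ae_restrict_Ioc_mem_Ioo u v).mono fun χ hχ => ?_)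
  obtain ⟨hnonneg, hradius⟩ := hle χ hχ
  have hmono : Real.cosh (a χ) ≤ Real.cosh (geodesicRadius u v χ) :=
    Real.cosh_strictMonoOn.monotoneOn hnonneg (hnonneg.trans hradius) hradius
  beta_reduce
  rw [radialVolume_of_forall_mem_iff hnonneg hradius (hQ χ hχ),
    ← ENNReal.ofReal_add (sub_nonneg.2 hmono) (Real.cosh_pos _).le, sub_add_cancel]

theorem setLIntegral_Ioc_eq_sum {x : ℕ → ℝ} (hx : Monotone x) (f : ℝ → ℝ≥0∞) (N : ℕ) :
    ∫⁻ χ in Ioc (x 0) (x N), f χ =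
      ∑ i ∈ Finset.range N, ∫⁻ χ in Ioc (x i) (x (i + 1)), f χ := by
  induction N with
  | zero => simp
  | succ N ih =>
    rw [Finset.sum_range_succ, ← ih,
      ← Ioc_union_Ioc_eq_Ioc (hx N.zero_le) (hx N.le_succ),
      lintegral_union measurableSet_Ioc (Ioc_disjoint_Ioc_of_le le_rfl)]

theorem setLIntegral_radialVolume_fan {Q : Set ℂ} {x : ℕ → ℝ} (hx : StrictMono x) (N : ℕ)
    {a : ℝ → ℝ} (ha : Measurable a) (hπ : ∀ i < N, x (i + 1) ≤ x i + π)
    (hle : ∀ i < N, ∀ χ ∈ Ioo (x i) (x (i + 1)),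
      0 ≤ a χ ∧ a χ ≤ geodesicRadius (x i) (x (i + 1)) χ)
    (hQ : ∀ i < N, ∀ χ ∈ Ioo (x i) (x (i + 1)), ∀ ρ, 0 < ρ →
      (bulkPoint ρ χ ∈ Q ↔ a χ ≤ ρ ∧ ρ ≤ geodesicRadius (x i) (x (i + 1)) χ)) :
    (∫⁻ χ in Ioc (x 0) (x N), radialVolume Q χ) +
        ∫⁻ χ in Ioc (x 0) (x N), ENNReal.ofReal (Real.cosh (a χ)) =
      ENNReal.ofReal (N * π) := by
  rw [setLIntegral_Ioc_eq_sum hx.monotone, setLIntegral_Ioc_eq_sum hx.monotone,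
    ← Finset.sum_add_distrib, Finset.sum_congr rfl fun i hi =>
      setLIntegral_radialVolume_add (hx i.lt_succ_self) (hπ i (Finset.mem_range.1 hi)) ha
        (hle i (Finset.mem_range.1 hi)) (hQ i (Finset.mem_range.1 hi)),
    Finset.sum_const, Finset.card_range, nsmul_eq_mul, ENNReal.ofReal_mul N.cast_nonneg,
    ENNReal.ofReal_natCast]

theorem radialVolume_idealPolygon_eq_zero {x : ℕ → ℝ} {i : ℕ} (hπ : x i + π < x (i + 1))
    (hle : x (i + 1) ≤ x i + 2 * π) {χ : ℝ} (hχ : χ ∈ Ioo (x i) (x (i + 1))) :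
    radialVolume (idealPolygon x) χ = 0 :=
  setLIntegral_eq_zero measurableSet_Ioi fun ρ hρ => by
    rw [indicator_of_notMem fun h => h.2 i (bulkPoint_mem_intervalRegion_of_pi_lt hπ hle hχ
      (mem_Ioi.1 hρ).le), mul_zero, Pi.zero_apply]

namespace IsVertexSequence

variable {n : ℕ} {x : ℕ → ℝ}

-- Every side faces the centre: the polygon is the union of `n + 2` sectors.
theorem setLIntegral_radialVolume_of_le_add_pi (hx : IsVertexSequence (n + 2) x)
    (hπ : ∀ i < n + 2, x (i + 1) ≤ x i + π) :
    ∫⁻ χ in Ioc (x 0) (x 0 + 2 * π), radialVolume (idealPolygon x) χ =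
      ENNReal.ofReal (n * π) := by
  have hfan := setLIntegral_radialVolume_fan (Q := idealPolygon x) (a := 0) hx.strictMono (n + 2)
    measurable_const hπ (fun i hi χ hχ => ⟨le_rfl, geodesicRadius_nonneg (hπ i hi) hχ⟩)
    fun i hi χ hχ ρ hρ => by
      rw [hx.bulkPoint_mem_idealPolygon_iff hi hρ.le hχ,
        ← bulkPoint_notMem_intervalRegion_iff (hπ i hi) hχ]
      refine ⟨fun h => ⟨hρ.le, h i hi (.inl rfl)⟩, fun h k hk hfacing => ?_⟩
      obtain rfl := hfacing.resolve_right (hπ k hk).not_gt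
      exact h.2
  have hx0 : x (n + 2) = x 0 + 2 * π := by simpa using hx.add_period 0
  have hsum : ENNReal.ofReal ((n + 2 : ℕ) * π) =
      ENNReal.ofReal (n * π) + ENNReal.ofReal (2 * π) := by
    rw [← ENNReal.ofReal_add (by positivity) (by positivity)]
    push_cast
    ring_nf
  rw [hx0, hsum] at hfan
  simp only [Pi.zero_apply, Real.cosh_zero, ENNReal.ofReal_one, lintegral_const,
    Measure.restrict_apply_univ, Real.volume_Ioc, add_sub_cancel_left, one_mul] at hfan
  exact (ENNReal.add_left_inj ENNReal.ofReal_ne_top).1 hfan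

-- The last side separates the polygon from the centre: the polygon is the union of the `n + 1`
-- sectors over the other sides, truncated below by the last side.
theorem setLIntegral_radialVolume_of_add_pi_lt (hx : IsVertexSequence (n + 2) x)
    (hlast : x (n + 1) + π < x (n + 2)) :
    ∫⁻ χ in Ioc (x 0) (x 0 + 2 * π), radialVolume (idealPolygon x) χ =
      ENNReal.ofReal (n * π) := by
  have hx0 : x (n + 2) = x 0 + 2 * π := by simpa using hx.add_period 0
  have hspan : x (n + 1) ≤ x 0 + π := by linarith
  have hfirst {i : ℕ} : x 0 ≤ x i := hx.strictMono.monotone i.zero_le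
  have hend {i : ℕ} (hi : i < n + 1) : x (i + 1) ≤ x (n + 1) := hx.strictMono.monotone hi
  have hπ : ∀ i < n + 1, x (i + 1) ≤ x i + π := fun i hi => by
    linarith [hend hi, hfirst (i := i)]
  have hχ₀ {i : ℕ} (hi : i < n + 1) {χ : ℝ} (hχ : χ ∈ Ioo (x i) (x (i + 1))) :
      χ ∈ Ioo (x 0) (x (n + 1)) := Ioo_subset_Ioo hfirst (hend hi) hχ
  have hfan := setLIntegral_radialVolume_fan (Q := idealPolygon x) hx.strictMono (n + 1)
    (measurable_geodesicRadius (x 0) (x (n + 1))) hπ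
    (fun i hi χ hχ => ⟨geodesicRadius_nonneg hspan (hχ₀ hi hχ),
      geodesicRadius_le_geodesicRadius hfirst (hend hi) hspan hχ⟩)
    fun i hi χ hχ ρ hρ => by
      rw [hx.bulkPoint_mem_idealPolygon_iff (hi.trans (n + 1).lt_succ_self) hρ.le hχ,
        ← bulkPoint_notMem_intervalRegion_iff (hπ i hi) hχ,
        ← bulkPoint_notMem_intervalRegion_add_two_pi_iff hspan (hχ₀ hi hχ), ← hx0]
      refine ⟨fun h => ⟨h (n + 1) (n + 1).lt_succ_self (.inr hlast),
        h i (hi.trans (n + 1).lt_succ_self) (.inl rfl)⟩, fun h k hk hfacing => ?_⟩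
      rcases (Nat.lt_succ_iff.1 hk).lt_or_eq with hk | rfl
      · obtain rfl := hfacing.resolve_right (hπ k hk).not_gt
        exact h.2
      · exact h.1
  rw [setLIntegral_cosh_geodesicRadius (hx.strictMono n.succ_pos) hspan, Nat.cast_add_one,
    add_one_mul, ENNReal.ofReal_add (by positivity) pi_pos.le] at hfan
  have hvanish : ∫⁻ χ in Ioc (x (n + 1)) (x (n + 2)), radialVolume (idealPolygon x) χ = 0 := by
    rw [← lintegral_zero]
    exact lintegral_congr_ae <| (ae_restrict_Ioc_mem_Ioo _ _).mono fun χ =>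
      radialVolume_idealPolygon_eq_zero hlast (by linarith [hfirst (i := n + 1)])
  rw [← hx0, ← Ioc_union_Ioc_eq_Ioc (hx.strictMono.monotone (n + 1).zero_le)
    (hx.strictMono.monotone (n + 1).le_succ), lintegral_union measurableSet_Ioc
    (Ioc_disjoint_Ioc_of_le le_rfl), hvanish, add_zero]
  exact (ENNReal.add_left_inj ENNReal.ofReal_ne_top).1 hfan

theorem sliceVolume_idealPolygon (hx : IsVertexSequence (n + 2) x) (L : ℝ) :
    sliceVolume L (idealPolygon x) = ENNReal.ofReal (L ^ 2 * (n * π)) := by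
  rw [ENNReal.ofReal_mul (sq_nonneg L)]
  by_cases hπ : ∀ i < n + 2, x (i + 1) ≤ x i + π
  · rw [sliceVolume_eq_lintegral_radialVolume L (measurableSet_idealPolygon x) (x 0),
      hx.setLIntegral_radialVolume_of_le_add_pi hπ]
  · push Not at hπ
    obtain ⟨i, -, hi⟩ := hπ
    have hlast : x (n + 1 + (i + 1)) + π < x (n + 2 + (i + 1)) := by
      rw [show n + 1 + (i + 1) = i + (n + 2) by ring, add_comm (n + 2), hx.add_period,
        hx.add_period]
      linarith
    rw [← hx.idealPolygon_comp_add (i + 1),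
      sliceVolume_eq_lintegral_radialVolume L (measurableSet_idealPolygon _) (x (0 + (i + 1))),
      (hx.comp_add (i + 1)).setLIntegral_radialVolume_of_add_pi_lt hlast]

end IsVertexSequence

/-- The successive vertices of the causal shadow of `[a₁, b₁]` and `[a₂, b₂]`, as an ideal
quadrilateral. -/
noncomputable def shadowVertex (a₁ b₁ a₂ b₂ : ℝ) : ℕ → ℝ
  | 0 => a₁
  | 1 => b₁
  | 2 => a₂
  | 3 => b₂
  | n + 4 => shadowVertex a₁ b₁ a₂ b₂ n + 2 * π

theorem isVertexSequence_shadowVertex {a₁ b₁ a₂ b₂ : ℝ} (h₁ : a₁ < b₁) (h₂ : b₁ < a₂)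
    (h₃ : a₂ < b₂) (h₄ : b₂ < a₁ + 2 * π) : IsVertexSequence 4 (shadowVertex a₁ b₁ a₂ b₂) where
  strictMono := strictMono_nat_of_lt_succ fun n => by
    induction n using Nat.strong_induction_on with
    | _ n ih =>
      match n with
      | 0 => exact h₁
      | 1 => exact h₂
      | 2 => exact h₃
      | 3 => exact h₄
      | n + 4 => exact add_lt_add_left (ih n (by omega)) _
  add_period _ := rfl

theorem causalShadow_eq_idealPolygon {a₁ b₁ a₂ b₂ : ℝ} (h₁ : a₁ < b₁) (h₂ : b₁ < a₂)
    (h₃ : a₂ < b₂) (h₄ : b₂ < a₁ + 2 * π) :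
    causalShadow a₁ b₁ a₂ b₂ = idealPolygon (shadowVertex a₁ b₁ a₂ b₂) := by
  ext z
  rw [(isVertexSequence_shadowVertex h₁ h₂ h₃ h₄).mem_idealPolygon_iff]
  simp only [Nat.forall_lt_succ_right, shadowVertex, causalShadow, mem_ofPred_eq,
    Nat.not_lt_zero, IsEmpty.forall_iff, implies_true, true_and, and_assoc]

theorem sliceVolume_causalShadow {a₁ b₁ a₂ b₂ : ℝ} (h₁ : a₁ < b₁) (h₂ : b₁ < a₂) (h₃ : a₂ < b₂)
    (h₄ : b₂ < a₁ + 2 * π) (L : ℝ) :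
    sliceVolume L (causalShadow a₁ b₁ a₂ b₂) = ENNReal.ofReal (2 * π * L ^ 2) := by
  rw [causalShadow_eq_idealPolygon h₁ h₂ h₃ h₄,
    (isVertexSequence_shadowVertex h₁ h₂ h₃ h₄).sliceVolume_idealPolygon, mul_comm]
  norm_num

theorem measurableSet_causalShadow {a₁ b₁ a₂ b₂ : ℝ} (h₁ : a₁ < b₁) (h₂ : b₁ < a₂)
    (h₃ : a₂ < b₂) (h₄ : b₂ < a₁ + 2 * π) : MeasurableSet (causalShadow a₁ b₁ a₂ b₂) := by
  rw [causalShadow_eq_idealPolygon h₁ h₂ h₃ h₄]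
  exact measurableSet_idealPolygon _

/-! ### Chords of ideal polygons -/

theorem sin_half_mul_sin_half_le {a b c d : ℝ} (hab : a ≤ b) (hbc : b ≤ c) (hcd : c ≤ d)
    (hda : d ≤ a + 2 * π) :
    Real.sin ((b - a) / 2) * Real.sin ((d - c) / 2) ≤
      Real.sin ((c - a) / 2) * Real.sin ((d - b) / 2) := by
  have hcb : 0 ≤ Real.sin ((c - b) / 2) :=
    Real.sin_nonneg_of_nonneg_of_le_pi (by linarith) (by linarith)
  have hda' : 0 ≤ Real.sin ((d - a) / 2) :=
    Real.sin_nonneg_of_nonneg_of_le_pi (by linarith) (by linarith)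
  -- Ptolemy's theorem for the cyclic quadrilateral with vertices at the angles `a, b, c, d`.
  have hptolemy : Real.sin ((c - a) / 2) * Real.sin ((d - b) / 2) =
      Real.sin ((b - a) / 2) * Real.sin ((d - c) / 2) +
        Real.sin ((d - a) / 2) * Real.sin ((c - b) / 2) := by
    have hhalf (x y : ℝ) : (x - y) / 2 = x / 2 - y / 2 := by ring
    simp only [hhalf, Real.sin_sub]
    ring
  linarith [mul_nonneg hda' hcb]

theorem cos_sub_sub_cos_half (U V w : ℝ) :
    Real.cos (w - (U + V) / 2) - Real.cos ((V - U) / 2) =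
      2 * (Real.sin ((w - U) / 2) * Real.sin ((V - w) / 2)) := by
  rw [Real.cos_sub_cos]
  have hsum : (w - (U + V) / 2 + (V - U) / 2) / 2 = (w - U) / 2 := by ring
  have hdiff : (w - (U + V) / 2 - (V - U) / 2) / 2 = -((V - w) / 2) := by ring
  rw [hsum, hdiff, Real.sin_neg]
  ring

theorem two_mul_geodesicPoint (u v s : ℝ) :
    2 * geodesicPoint u v s = (1 - Real.tanh s : ℝ) * Complex.exp (u * Complex.I) +
      (1 + Real.tanh s : ℝ) * Complex.exp (v * Complex.I) := by
  have hu : u = (u + v) / 2 + -((v - u) / 2) := by ring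
  have hv : v = (u + v) / 2 + (v - u) / 2 := by ring
  have hsplit (a b : ℝ) : Complex.exp ((a + b : ℝ) * Complex.I) =
      Complex.exp (a * Complex.I) * (Real.cos b + Real.sin b * Complex.I) := by
    rw [Complex.ofReal_add, add_mul, Complex.exp_add, Complex.exp_mul_I b, Complex.ofReal_cos,
      Complex.ofReal_sin]
  nth_rewrite 2 [hu]
  nth_rewrite 4 [hv]
  rw [hsplit, hsplit, geodesicPoint, Real.cos_neg, Real.sin_neg]
  push_cast
  ring

theorem norm_geodesicPoint_lt_one {u v : ℝ} (h : Real.sin ((v - u) / 2) ≠ 0) (s : ℝ) :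
    ‖geodesicPoint u v s‖ < 1 := by
  rw [norm_geodesicPoint, Real.sqrt_lt' one_pos, Real.cos_sq']
  nlinarith [Real.tanh_sq_lt_one s, sq_pos_of_ne_zero h]

theorem geodesicPoint_notMem_intervalRegion_iff {u v s : ℝ} (h : ‖geodesicPoint u v s‖ < 1)
    (U V : ℝ) :
    geodesicPoint u v s ∉ intervalRegion U V ↔
      (1 - Real.tanh s) * (Real.cos (u - (U + V) / 2) - Real.cos ((V - U) / 2)) +
        (1 + Real.tanh s) * (Real.cos (v - (U + V) / 2) - Real.cos ((V - U) / 2)) ≤ 0 := by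
  have hrot (w : ℝ) : (Complex.exp (w * Complex.I) *
      Complex.exp (-((U + V) / 2 : ℝ) * Complex.I)).re = Real.cos (w - (U + V) / 2) := by
    rw [← Complex.exp_add, ← add_mul, ← sub_eq_add_neg, ← Complex.ofReal_sub,
      Complex.exp_ofReal_mul_I_re]
  have hre : 2 * (geodesicPoint u v s * Complex.exp (-((U + V) / 2 : ℝ) * Complex.I)).re =
      (1 - Real.tanh s) * Real.cos (u - (U + V) / 2) +
        (1 + Real.tanh s) * Real.cos (v - (U + V) / 2) := by
    rw [← hrot u, ← hrot v, ← Complex.re_ofReal_mul, ← Complex.re_ofReal_mul,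
      ← Complex.re_ofReal_mul, ← Complex.add_re, Complex.ofReal_ofNat, ← mul_assoc,
      two_mul_geodesicPoint, add_mul, mul_assoc, mul_assoc]
  simp only [intervalRegion, mem_ofPred_eq, h, true_and, not_lt]
  constructor <;> intro _ <;> linarith

/-- The value of `tanh s` at the parameter `s` where the geodesic `(u, v)` meets the geodesic
`(U, V)`, when they meet. -/
noncomputable def geodesicCrossing (U V u v : ℝ) : ℝ :=
  (Real.cos (u - (U + V) / 2) + Real.cos (v - (U + V) / 2) - 2 * Real.cos ((V - U) / 2)) /
    (Real.cos (u - (U + V) / 2) - Real.cos (v - (U + V) / 2))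

theorem geodesicCrossing_swap (U V u v : ℝ) :
    geodesicCrossing U V v u = -geodesicCrossing U V u v := by
  rw [geodesicCrossing, geodesicCrossing, ← div_neg, neg_sub, add_comm (Real.cos _)]

theorem geodesicCrossing_mem_Ioo {U V u v : ℝ}
    (hu : Real.cos ((V - U) / 2) < Real.cos (u - (U + V) / 2))
    (hv : Real.cos (v - (U + V) / 2) < Real.cos ((V - U) / 2)) :
    geodesicCrossing U V u v ∈ Ioo (-1) 1 := by
  have hpos : 0 < Real.cos (u - (U + V) / 2) - Real.cos (v - (U + V) / 2) := by linarith
  rw [geodesicCrossing, mem_Ioo, lt_div_iff₀ hpos, div_lt_iff₀ hpos]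
  constructor <;> linarith

theorem geodesicPoint_notMem_intervalRegion_iff_crossing_le {U V u v s : ℝ}
    (h : ‖geodesicPoint u v s‖ < 1)
    (hu : Real.cos ((V - U) / 2) < Real.cos (u - (U + V) / 2))
    (hv : Real.cos (v - (U + V) / 2) < Real.cos ((V - U) / 2)) :
    geodesicPoint u v s ∉ intervalRegion U V ↔ geodesicCrossing U V u v ≤ Real.tanh s := by
  rw [geodesicPoint_notMem_intervalRegion_iff h, geodesicCrossing, div_le_iff₀ (by linarith)]
  constructor <;> intro _ <;> linarith

theorem geodesicPoint_swap (u v s : ℝ) : geodesicPoint v u s = geodesicPoint u v (-s) := by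
  rw [← mul_right_inj' (two_ne_zero (α := ℂ)), two_mul_geodesicPoint, two_mul_geodesicPoint,
    Real.tanh_neg, sub_neg_eq_add, ← sub_eq_add_neg, add_comm]

theorem geodesicPoint_notMem_intervalRegion_iff_le_crossing {U V u v s : ℝ}
    (h : ‖geodesicPoint u v s‖ < 1)
    (hu : Real.cos (u - (U + V) / 2) < Real.cos ((V - U) / 2))
    (hv : Real.cos ((V - U) / 2) < Real.cos (v - (U + V) / 2)) :
    geodesicPoint u v s ∉ intervalRegion U V ↔ Real.tanh s ≤ geodesicCrossing U V u v := by
  rw [geodesicPoint_swap] at h ⊢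
  rw [geodesicPoint_notMem_intervalRegion_iff_crossing_le h hv hu, geodesicCrossing_swap,
    Real.tanh_neg, neg_le_neg_iff]

theorem geodesicPoint_notMem_intervalRegion {U V u v s : ℝ} (h : ‖geodesicPoint u v s‖ < 1)
    (hu : Real.cos (u - (U + V) / 2) ≤ Real.cos ((V - U) / 2))
    (hv : Real.cos (v - (U + V) / 2) ≤ Real.cos ((V - U) / 2)) :
    geodesicPoint u v s ∉ intervalRegion U V := by
  rw [geodesicPoint_notMem_intervalRegion_iff h]
  nlinarith [Real.neg_one_lt_tanh s, Real.tanh_lt_one s]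

theorem geodesicPoint_mem_intervalRegion {U V u v s : ℝ} (h : ‖geodesicPoint u v s‖ < 1)
    (hu : Real.cos ((V - U) / 2) < Real.cos (u - (U + V) / 2))
    (hv : Real.cos ((V - U) / 2) < Real.cos (v - (U + V) / 2)) :
    geodesicPoint u v s ∈ intervalRegion U V := by
  rw [← not_not (a := _ ∈ _), geodesicPoint_notMem_intervalRegion_iff h, not_le]
  nlinarith [Real.neg_one_lt_tanh s, Real.tanh_lt_one s]

theorem geodesicCrossing_le_geodesicCrossing {U V U' V' u v : ℝ} (hu : u ∈ Ioo U V)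
    (hVU : V ≤ U') (hv : v ∈ Ioo U' V') (hVU' : V' ≤ U + 2 * π) :
    geodesicCrossing U V u v ≤ geodesicCrossing U' V' u v := by
  obtain ⟨hUu, huV⟩ := hu
  obtain ⟨hUv, hvV⟩ := hv
  have hpos : 0 < Real.cos (u - (U + V) / 2) - Real.cos (v - (U + V) / 2) :=
    sub_pos.2 ((cos_sub_lt_cos_half (by linarith) ⟨hVU.trans_lt hUv, hvV.trans_le hVU'⟩).trans
      (cos_half_lt_cos_sub (by linarith) ⟨hUu, huV⟩))
  have hneg : Real.cos (u - (U' + V') / 2) - Real.cos (v - (U' + V') / 2) < 0 := by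
    have hu' := cos_sub_lt_cos_half (χ := u + 2 * π) (hUv.trans hvV).le
      ⟨by linarith, by linarith⟩
    rw [add_sub_right_comm, Real.cos_add_two_pi] at hu'
    exact sub_neg.2 (hu'.trans (cos_half_lt_cos_sub (by linarith) ⟨hUv, hvV⟩))
  have houter := sin_half_mul_sin_half_le hUu.le (by linarith) hvV.le hVU'
  have hinner := sin_half_mul_sin_half_le huV.le hVU hUv.le (by linarith)
  have hmul := mul_le_mul houter hinner
    (mul_nonneg (sin_half_sub_pos huV (by linarith)).le (sin_half_sub_pos hUv (by linarith)).le)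
    (mul_nonneg (sin_half_sub_pos (by linarith) (by linarith)).le
      (sin_half_sub_pos (by linarith) (by linarith)).le)
  have hp := cos_sub_sub_cos_half U V u
  have hq := cos_sub_sub_cos_half U V v
  have hp' := cos_sub_sub_cos_half U' V' u
  have hq' := cos_sub_sub_cos_half U' V' v
  rw [← neg_sub v V, neg_div, Real.sin_neg] at hq
  rw [← neg_sub U' u, neg_div, Real.sin_neg] at hp'
  rw [sub_eq_iff_eq_add] at hp hq hp' hq'
  rw [geodesicCrossing, geodesicCrossing, div_le_iff₀ hpos, div_mul_eq_mul_div,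
    le_div_iff_of_neg hneg, hp, hq, hp', hq']
  linear_combination 8 * hmul

theorem artanh_neg_eq (x : ℝ) : artanh (-x) = -artanh x := by
  rw [artanh, artanh, sub_neg_eq_add, ← sub_eq_add_neg, ← inv_div, Real.sqrt_inv, Real.log_inv]

namespace IsVertexSequence

variable {n i j : ℕ} {x : ℕ → ℝ} {u v : ℝ}

theorem sin_half_sub_pos (hx : IsVertexSequence n x) (hij : i < j) (hj : j < n)
    (hu : u ∈ Ioo (x i) (x (i + 1))) (hv : v ∈ Ioo (x j) (x (j + 1))) :
    0 < Real.sin ((v - u) / 2) :=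
  _root_.sin_half_sub_pos (hu.2.trans_le ((hx.strictMono.monotone hij).trans hv.1.le))
    (by linarith [hu.1, hv.2, hx.le_add_two_pi (k := i) hj])

theorem geodesicPoint_mem_idealPolygon_iff (hx : IsVertexSequence n x) (hij : i < j) (hj : j < n)
    (hu : u ∈ Ioo (x i) (x (i + 1))) (hv : v ∈ Ioo (x j) (x (j + 1))) (s : ℝ) :
    geodesicPoint u v s ∈ idealPolygon x ↔
      Real.tanh s ∈ Icc (geodesicCrossing (x i) (x (i + 1)) u v)
        (geodesicCrossing (x j) (x (j + 1)) u v) := by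
  have hi : i < n := hij.trans hj
  have hnorm := norm_geodesicPoint_lt_one (hx.sin_half_sub_pos hij hj hu hv).ne' s
  have hentry := geodesicPoint_notMem_intervalRegion_iff_crossing_le hnorm
    (cos_half_lt_cos_sub (hx.le_add_two_pi hi) hu) (hx.cos_sub_lt_cos_half hj hi hij.ne hv)
  have hexit := geodesicPoint_notMem_intervalRegion_iff_le_crossing hnorm
    (hx.cos_sub_lt_cos_half hi hj hij.ne' hu) (cos_half_lt_cos_sub (hx.le_add_two_pi hj) hv)
  rw [hx.mem_idealPolygon_iff, mem_Icc, ← hentry, ← hexit]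
  refine ⟨fun h => ⟨h.2 i hi, h.2 j hj⟩, fun h => ⟨hnorm, fun k hk => ?_⟩⟩
  rcases eq_or_ne k i with rfl | hki
  · exact h.1
  rcases eq_or_ne k j with rfl | hkj
  · exact h.2
  exact geodesicPoint_notMem_intervalRegion hnorm (hx.cos_sub_lt_cos_half hi hk hki hu).le
    (hx.cos_sub_lt_cos_half hj hk hkj hv).le

theorem geodesicCrossing_mem_Ioo_left (hx : IsVertexSequence n x) (hij : i < j) (hj : j < n)
    (hu : u ∈ Ioo (x i) (x (i + 1))) (hv : v ∈ Ioo (x j) (x (j + 1))) :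
    geodesicCrossing (x i) (x (i + 1)) u v ∈ Ioo (-1) 1 :=
  geodesicCrossing_mem_Ioo (cos_half_lt_cos_sub (hx.le_add_two_pi (hij.trans hj)) hu)
    (hx.cos_sub_lt_cos_half hj (hij.trans hj) hij.ne hv)

theorem geodesicCrossing_mem_Ioo_right (hx : IsVertexSequence n x) (hij : i < j) (hj : j < n)
    (hu : u ∈ Ioo (x i) (x (i + 1))) (hv : v ∈ Ioo (x j) (x (j + 1))) :
    geodesicCrossing (x j) (x (j + 1)) u v ∈ Ioo (-1) 1 := by
  have h := geodesicCrossing_mem_Ioo (cos_half_lt_cos_sub (hx.le_add_two_pi hj) hv)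
    (hx.cos_sub_lt_cos_half (hij.trans hj) hj hij.ne' hu)
  rw [geodesicCrossing_swap] at h
  exact ⟨by linarith [h.2], by linarith [h.1]⟩

theorem artanh_geodesicCrossing_le (hx : IsVertexSequence n x) (hij : i < j) (hj : j < n)
    (hu : u ∈ Ioo (x i) (x (i + 1))) (hv : v ∈ Ioo (x j) (x (j + 1))) :
    artanh (geodesicCrossing (x i) (x (i + 1)) u v) ≤
      artanh (geodesicCrossing (x j) (x (j + 1)) u v) :=
  artanh_le_artanh (hx.geodesicCrossing_mem_Ioo_left hij hj hu hv).1
    (hx.geodesicCrossing_mem_Ioo_right hij hj hu hv).2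
    (geodesicCrossing_le_geodesicCrossing hu (hx.strictMono.monotone hij) hv (hx.le_add_two_pi hj))

theorem chordLength_idealPolygon (hx : IsVertexSequence n x) (hij : i < j) (hj : j < n)
    (hu : u ∈ Ioo (x i) (x (i + 1))) (hv : v ∈ Ioo (x j) (x (j + 1))) (L : ℝ) :
    chordLength L (idealPolygon x) u v = ENNReal.ofReal L *
      ENNReal.ofReal (artanh (geodesicCrossing (x j) (x (j + 1)) u v) -
        artanh (geodesicCrossing (x i) (x (i + 1)) u v)) := by
  have hset : {s : ℝ | geodesicPoint u v s ∈ idealPolygon x} =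
      Icc (artanh (geodesicCrossing (x i) (x (i + 1)) u v))
        (artanh (geodesicCrossing (x j) (x (j + 1)) u v)) := by
    ext s
    rw [mem_ofPred_eq, hx.geodesicPoint_mem_idealPolygon_iff hij hj hu hv, mem_Icc, mem_Icc,
      le_tanh_iff (hx.geodesicCrossing_mem_Ioo_left hij hj hu hv),
      tanh_le_iff (hx.geodesicCrossing_mem_Ioo_right hij hj hu hv)]
  rw [chordLength, hset, Real.volume_Icc]

theorem chordLength_idealPolygon_eq_zero (hx : IsVertexSequence n x) (hi : i < n)
    (hu : u ∈ Ioo (x i) (x (i + 1))) (hv : v ∈ Ioo (x i) (x (i + 1))) (L : ℝ) :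
    chordLength L (idealPolygon x) u v = 0 := by
  have hnotMem (s : ℝ) : geodesicPoint u v s ∉ idealPolygon x := fun hs =>
    hs.2 i (geodesicPoint_mem_intervalRegion hs.1
      (cos_half_lt_cos_sub (hx.le_add_two_pi hi) hu) (cos_half_lt_cos_sub (hx.le_add_two_pi hi) hv))
  simp [chordLength, hnotMem]

end IsVertexSequence

/-! ### The chord functions of the symmetric causal shadow -/

theorem geodesicCrossing_eq (U V u v : ℝ) :
    geodesicCrossing U V u v =
      (Real.cos ((v - u) / 2) * Real.cos ((v + u) / 2 - (U + V) / 2) - Real.cos ((V - U) / 2)) /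
        (Real.sin ((v - u) / 2) * Real.sin ((v + u) / 2 - (U + V) / 2)) := by
  have hu : u - (U + V) / 2 = (v + u) / 2 - (U + V) / 2 - (v - u) / 2 := by ring
  have hv : v - (U + V) / 2 = (v + u) / 2 - (U + V) / 2 + (v - u) / 2 := by ring
  rw [geodesicCrossing, hu, hv, Real.cos_add, Real.cos_sub _ ((v - u) / 2),
    ← mul_div_mul_left _ (Real.sin ((v - u) / 2) * _) (two_ne_zero (α := ℝ))]
  congr 1 <;> ring

-- `arctan m` is the polar angle of the crossing of the geodesics with midpoint angles `θ` and `0`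
-- and half-widths `α` and `arccos (1 / c)`.
theorem sin_sub_arctan_div_sqrt {c α θ m : ℝ} (hc : 0 < c) (hα : 0 < Real.sin α)
    (hθ : Real.sin θ ≠ 0) (hm : m * Real.sin θ = c * Real.cos α - Real.cos θ) :
    Real.sin (θ - arctan m) / √(c ^ 2 * Real.cos (arctan m) ^ 2 - Real.cos (θ - arctan m) ^ 2) =
      (1 - c * (Real.cos α * Real.cos θ)) / (c * (Real.sin α * Real.sin θ)) := by
  have hpos := Real.cos_arctan_pos m
  have hsin : Real.sin (arctan m) = m * Real.cos (arctan m) := by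
    rw [← Real.tan_mul_cos hpos.ne', Real.tan_arctan]
  have hcos : Real.cos (θ - arctan m) = Real.cos (arctan m) * (c * Real.cos α) := by
    rw [Real.cos_sub, hsin]
    linear_combination Real.cos (arctan m) * hm
  have hroot : c ^ 2 * Real.cos (arctan m) ^ 2 - Real.cos (θ - arctan m) ^ 2 =
      (c * Real.cos (arctan m) * Real.sin α) ^ 2 := by
    rw [hcos, mul_pow _ (Real.sin α), Real.sin_sq]
    ring
  rw [hroot, Real.sqrt_sq (by positivity), Real.sin_sub, hsin,
    div_eq_div_iff (by positivity) (by positivity)]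
  linear_combination c * Real.cos (arctan m) * Real.sin α *
    (Real.sin_sq_add_cos_sq θ - Real.cos θ * hm)

theorem artanh_sin_sub_arctan_div_sqrt {U V u v m : ℝ} (hUV : (V - U) / 2 = π / 4)
    (hα : 0 < Real.sin ((v - u) / 2)) (hθ : Real.sin ((v + u) / 2 - (U + V) / 2) ≠ 0)
    (hm : m * Real.sin ((v + u) / 2 - (U + V) / 2) =
      √2 * Real.cos ((v - u) / 2) - Real.cos ((v + u) / 2 - (U + V) / 2)) :
    artanh (Real.sin ((v + u) / 2 - (U + V) / 2 - arctan m) /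
        √(2 * Real.cos (arctan m) ^ 2 - Real.cos ((v + u) / 2 - (U + V) / 2 - arctan m) ^ 2)) =
      -artanh (geodesicCrossing U V u v) := by
  have hformula := sin_sub_arctan_div_sqrt (by positivity) hα hθ hm
  have hsqrt : √2 * (√2 / 2) = 1 := by
    rw [mul_div_assoc', Real.mul_self_sqrt two_pos.le, div_self two_ne_zero]
  rw [Real.sq_sqrt two_pos.le] at hformula
  rw [hformula, ← artanh_neg_eq, geodesicCrossing_eq, hUV, Real.cos_pi_div_four, ← neg_div, neg_sub,
    ← mul_div_mul_left (√2 / 2 - _) _ (by positivity : √2 ≠ 0), mul_sub √2, hsqrt]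

theorem artanh_sin_sub_chiIn {u v : ℝ} (hα : 0 < Real.sin ((v - u) / 2))
    (hsin : Real.sin ((v + u) / 2) ≠ 0) :
    artanh (Real.sin ((v + u) / 2 - chiIn u v) /
        √(2 * Real.cos (chiIn u v) ^ 2 - Real.cos ((v + u) / 2 - chiIn u v) ^ 2)) =
      -artanh (geodesicCrossing (-(π / 4)) (π / 4) u v) := by
  have h := artanh_sin_sub_arctan_div_sqrt (U := -(π / 4)) (V := π / 4) (by ring) hα
    (by simpa using hsin) (m := (√2 * Real.cos ((v - u) / 2) - Real.cos ((v + u) / 2)) /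
      Real.sin ((v + u) / 2)) (by simp [hsin])
  rwa [neg_add_cancel, zero_div, sub_zero, ← chiIn] at h

theorem artanh_sin_sub_chiOutI {u v : ℝ} (hα : 0 < Real.sin ((v - u) / 2))
    (hcos : Real.cos ((v + u) / 2) ≠ 0) :
    artanh (Real.sin ((v + u) / 2 - chiOutI u v) /
        √(2 * Real.sin (chiOutI u v) ^ 2 - Real.cos ((v + u) / 2 - chiOutI u v) ^ 2)) =
      -artanh (geodesicCrossing (π / 4) (3 * π / 4) u v) := by
  have hmid : (π / 4 + 3 * π / 4) / 2 = π / 2 := by ring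
  have h := artanh_sin_sub_arctan_div_sqrt (U := π / 4) (V := 3 * π / 4) (by ring) hα
    (by simpa [hmid, Real.sin_sub_pi_div_two] using hcos)
    (m := -((√2 * Real.cos ((v - u) / 2) - Real.sin ((v + u) / 2)) / Real.cos ((v + u) / 2)))
    (by simp [hmid, Real.sin_sub_pi_div_two, Real.cos_sub_pi_div_two, hcos])
  rw [hmid, arctan_neg, Real.cos_neg, ← Real.sin_pi_div_two_sub (arctan _), sub_sub,
    ← sub_eq_add_neg] at h
  exact h

theorem artanh_sin_sub_chiOutII {u v : ℝ} (hα : 0 < Real.sin ((v - u) / 2))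
    (hsin : Real.sin ((v + u) / 2) ≠ 0) :
    artanh (Real.sin ((v + u) / 2 - chiOutII u v) /
        √(2 * Real.cos (chiOutII u v) ^ 2 - Real.cos ((v + u) / 2 - chiOutII u v) ^ 2)) =
      -artanh (geodesicCrossing (3 * π / 4) (5 * π / 4) u v) := by
  have hmid : (3 * π / 4 + 5 * π / 4) / 2 = π := by ring
  have h := artanh_sin_sub_arctan_div_sqrt (U := 3 * π / 4) (V := 5 * π / 4) (by ring) hα
    (by simpa [hmid] using hsin)
    (m := -((√2 * Real.cos ((v - u) / 2) + Real.cos ((v + u) / 2)) / Real.sin ((v + u) / 2)))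
    (by simp [hmid, hsin])
  rw [hmid, sub_sub, ← neg_sq (Real.cos (arctan _)), ← Real.cos_add_pi, add_comm (arctan _)] at h
  exact h

theorem lambdaI_eq {u v : ℝ} (hu : u ∈ Ioo (-(π / 4)) (π / 4)) (hv : v ∈ Ioo (π / 4) (3 * π / 4))
    (L : ℝ) :
    lambdaI L u v = L * (artanh (geodesicCrossing (π / 4) (3 * π / 4) u v) -
      artanh (geodesicCrossing (-(π / 4)) (π / 4) u v)) := by
  have hα := sin_half_sub_pos (hu.2.trans hv.1) (by linarith [hu.1, hv.2, pi_pos])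
  have hsin : 0 < Real.sin ((v + u) / 2) :=
    Real.sin_pos_of_pos_of_lt_pi (by linarith [hu.1, hv.1]) (by linarith [hu.2, hv.2, pi_pos])
  have hcos : 0 < Real.cos ((v + u) / 2) :=
    Real.cos_pos_of_mem_Ioo ⟨by linarith [hu.1, hv.1, pi_pos], by linarith [hu.2, hv.2]⟩
  rw [lambdaI, artanh_sin_sub_chiIn hα hsin.ne', artanh_sin_sub_chiOutI hα hcos.ne', neg_sub_neg]

theorem lambdaII_eq {u v : ℝ} (hu : u ∈ Ioo (-(π / 4)) (π / 4))
    (hv : v ∈ Ioo (3 * π / 4) (5 * π / 4)) (L : ℝ) :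
    lambdaII L u v = L * (artanh (geodesicCrossing (3 * π / 4) (5 * π / 4) u v) -
      artanh (geodesicCrossing (-(π / 4)) (π / 4) u v)) := by
  have hα : 0 < Real.sin ((v - u) / 2) :=
    sin_half_sub_pos (by linarith [hu.2, hv.1, pi_pos]) (by linarith [hu.1, hv.2, pi_pos])
  have hsin : 0 < Real.sin ((v + u) / 2) :=
    Real.sin_pos_of_pos_of_lt_pi (by linarith [hu.1, hv.1, pi_pos])
      (by linarith [hu.2, hv.2, pi_pos])
  rw [lambdaII, artanh_sin_sub_chiIn hα hsin.ne', artanh_sin_sub_chiOutII hα hsin.ne', neg_sub_neg]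

/-- The successive vertices of the symmetric causal shadow, as an ideal square. -/
noncomputable def squareVertex : ℕ → ℝ :=
  shadowVertex (-(π / 4)) (π / 4) (3 * π / 4) (5 * π / 4)

theorem isVertexSequence_squareVertex : IsVertexSequence 4 squareVertex :=
  isVertexSequence_shadowVertex (by linarith [pi_pos]) (by linarith [pi_pos])
    (by linarith [pi_pos]) (by linarith [pi_pos])

theorem symmetricShadow_eq_idealPolygon : symmetricShadow = idealPolygon squareVertex :=
  causalShadow_eq_idealPolygon (by linarith [pi_pos]) (by linarith [pi_pos])
    (by linarith [pi_pos]) (by linarith [pi_pos])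

theorem measurableSet_symmetricShadow : MeasurableSet symmetricShadow :=
  symmetricShadow_eq_idealPolygon ▸ measurableSet_idealPolygon squareVertex

theorem lambdaI_nonneg {L u v : ℝ} (hL : 0 ≤ L) (hu : u ∈ Ioo (-(π / 4)) (π / 4))
    (hv : v ∈ Ioo (π / 4) (3 * π / 4)) : 0 ≤ lambdaI L u v := by
  have hle := isVertexSequence_squareVertex.artanh_geodesicCrossing_le (i := 0) (j := 1) zero_lt_one
    (by norm_num) hu hv
  rw [lambdaI_eq hu hv]
  exact mul_nonneg hL (sub_nonneg.2 hle)

theorem chordLength_symmetricShadow_eq_lambdaI {L u v : ℝ} (hL : 0 ≤ L)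
    (hu : u ∈ Ioo (-(π / 4)) (π / 4)) (hv : v ∈ Ioo (π / 4) (3 * π / 4)) :
    chordLength L symmetricShadow u v = ENNReal.ofReal (lambdaI L u v) := by
  rw [lambdaI_eq hu hv, ENNReal.ofReal_mul hL, symmetricShadow_eq_idealPolygon]
  exact isVertexSequence_squareVertex.chordLength_idealPolygon (i := 0) (j := 1) zero_lt_one
    (by norm_num) hu hv L

theorem lambdaII_nonneg {L u v : ℝ} (hL : 0 ≤ L) (hu : u ∈ Ioo (-(π / 4)) (π / 4))
    (hv : v ∈ Ioo (3 * π / 4) (5 * π / 4)) : 0 ≤ lambdaII L u v := by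
  have hle := isVertexSequence_squareVertex.artanh_geodesicCrossing_le (i := 0) (j := 2) zero_lt_two
    (by norm_num) hu hv
  rw [lambdaII_eq hu hv]
  exact mul_nonneg hL (sub_nonneg.2 hle)

theorem chordLength_symmetricShadow_eq_lambdaII {L u v : ℝ} (hL : 0 ≤ L)
    (hu : u ∈ Ioo (-(π / 4)) (π / 4)) (hv : v ∈ Ioo (3 * π / 4) (5 * π / 4)) :
    chordLength L symmetricShadow u v = ENNReal.ofReal (lambdaII L u v) := by
  rw [lambdaII_eq hu hv, ENNReal.ofReal_mul hL, symmetricShadow_eq_idealPolygon]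
  exact isVertexSequence_squareVertex.chordLength_idealPolygon (i := 0) (j := 2) zero_lt_two
    (by norm_num) hu hv L

/-! ### Symmetries of the symmetric causal shadow -/

theorem chordLength_idealPolygon_add_add (L c : ℝ) (x : ℕ → ℝ) (u v : ℝ) :
    chordLength L (idealPolygon fun i => x i + c) (u + c) (v + c) =
      chordLength L (idealPolygon x) u v := by
  simp only [chordLength, geodesicPoint_add_add, exp_mul_mem_idealPolygon_iff]

theorem chordLength_swap (L : ℝ) (Q : Set ℂ) (u v : ℝ) :
    chordLength L Q v u = chordLength L Q u v := by
  simp only [chordLength, geodesicPoint_swap u v]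
  congr 1
  exact Measure.measure_preimage_neg volume {s | geodesicPoint u v s ∈ Q}

theorem chordLength_add_two_pi_right (L : ℝ) (Q : Set ℂ) (u v : ℝ) :
    chordLength L Q u (v + 2 * π) = chordLength L Q u v := by
  have hpoint (s : ℝ) : geodesicPoint u (v + 2 * π) s = geodesicPoint u v s := by
    have hexp : Complex.exp ((v + 2 * π : ℝ) * Complex.I) = Complex.exp (v * Complex.I) :=
      periodic_exp_ofReal_mul_I v
    rw [← mul_right_inj' (two_ne_zero (α := ℂ)), two_mul_geodesicPoint, two_mul_geodesicPoint, hexp]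
  simp only [chordLength, hpoint]

theorem croftonDensity_swap (L G u v : ℝ) : croftonDensity L G v u = croftonDensity L G u v := by
  rw [croftonDensity, croftonDensity, ← neg_sub, neg_div, Real.sin_neg, neg_sq]

theorem croftonDensity_add_two_pi_right (L G u v : ℝ) :
    croftonDensity L G u (v + 2 * π) = croftonDensity L G u v := by
  have hhalf : (v + 2 * π - u) / 2 = (v - u) / 2 + π := by ring
  rw [croftonDensity, croftonDensity, hhalf, Real.sin_add_pi, neg_sq]

theorem squareVertex_succ (n : ℕ) : squareVertex (n + 1) = squareVertex n + π / 2 := by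
  induction n using Nat.strong_induction_on with
  | _ n ih =>
    match n with
    | 0 | 1 | 2 | 3 =>
      simp only [squareVertex, shadowVertex]
      ring
    | n + 4 =>
      have h := ih n (by omega)
      simp only [squareVertex, shadowVertex] at h ⊢
      linarith

theorem chordLength_symmetricShadow_add_pi_div_two (L u v : ℝ) :
    chordLength L symmetricShadow (u + π / 2) (v + π / 2) = chordLength L symmetricShadow u v := by
  rw [symmetricShadow_eq_idealPolygon, ← chordLength_idealPolygon_add_add L (π / 2) squareVertex u,
    ← isVertexSequence_squareVertex.idealPolygon_comp_add 1]
  simp only [squareVertex_succ]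

theorem chordLength_symmetricShadow_eq_zero (L : ℝ) {u v : ℝ}
    (hu : u ∈ Ioo (squareVertex 0) (squareVertex 1))
    (hv : v ∈ Ioo (squareVertex 0) (squareVertex 1)) : chordLength L symmetricShadow u v = 0 := by
  rw [symmetricShadow_eq_idealPolygon]
  exact isVertexSequence_squareVertex.chordLength_idealPolygon_eq_zero four_pos hu hv L

/-! ### The kinematic integral at the phase transition -/

theorem setLIntegral_kinematicSpace_of_periodic {f : ℝ → ℝ → ℝ≥0∞}
    (hf : Measurable (Function.uncurry f)) (hleft : ∀ u v, f (u + 2 * π) v = f u v)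
    (hright : ∀ u v, f u (v + 2 * π) = f u v) (c : ℝ) :
    ∫⁻ p in kinematicSpace, f p.1 p.2 =
      ∫⁻ u in Ioc c (c + 2 * π), ∫⁻ v in Ioc c (c + 2 * π), f u v := by
  have hshear : Measurable fun p : ℝ × ℝ => f p.2 (p.2 + p.1) :=
    hf.comp (by fun_prop : Measurable fun p : ℝ × ℝ => (p.2, p.2 + p.1))
  rw [setLIntegral_kinematicSpace hf (fun u v => by rw [hleft, hright]) c,
    lintegral_lintegral_swap hshear.aemeasurable]
  refine lintegral_congr fun u => ?_
  calc ∫⁻ d in Ioo 0 (2 * π), f u (u + d)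
      = ∫⁻ d in Ioc 0 (2 * π), f u (d + u) := by
        simp only [setLIntegral_congr Ioo_ae_eq_Ioc, add_comm u]
    _ = ∫⁻ v in Ioc u (u + 2 * π), f u v := by
        rw [setLIntegral_Ioc_comp_add_right, zero_add, add_comm]
    _ = ∫⁻ v in Ioc c (c + 2 * π), f u v :=
        setLIntegral_Ioc_add_eq_of_periodic two_pi_pos (hright u) u c

theorem setLIntegral_eq_four_mul_of_periodic {f : ℝ → ℝ≥0∞} (hf : Function.Periodic f (π / 2)) :
    ∫⁻ x in Ioc (squareVertex 0) (squareVertex 4), f x =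
      4 * ∫⁻ x in Ioc (squareVertex 0) (squareVertex 1), f x := by
  rw [setLIntegral_Ioc_eq_sum isVertexSequence_squareVertex.strictMono.monotone]
  simp only [squareVertex_succ, ← setLIntegral_Ioc_add_eq_of_periodic pi_div_two_pos hf
    (squareVertex 0), Finset.sum_const, Finset.card_range, nsmul_eq_mul, Nat.cast_ofNat]

theorem setLIntegral_Icc_prod_Icc {f : ℝ → ℝ → ℝ≥0∞} (hf : Measurable (Function.uncurry f))
    (a b c d : ℝ) :
    ∫⁻ p in Icc a b ×ˢ Icc c d, f p.1 p.2 = ∫⁻ u in Ioc a b, ∫⁻ v in Ioc c d, f u v := by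
  rw [Measure.volume_eq_prod, setLIntegral_prod (fun p => f p.1 p.2) hf.aemeasurable]
  simp only [restrict_Ioc_eq_restrict_Icc]

-- Exchanging the ends and turning by `π / 2` maps the geodesics from the first side to the fourth
-- one onto those from the first side to the second one.
theorem setLIntegral_fourth_side_eq_second_side {f : ℝ → ℝ → ℝ≥0∞}
    (hf : Measurable (Function.uncurry f)) (hswap : ∀ u v, f v u = f u v)
    (hper : ∀ u v, f u (v + 2 * π) = f u v) (hrot : ∀ u v, f (u + π / 2) (v + π / 2) = f u v) :
    ∫⁻ u in Ioc (squareVertex 0) (squareVertex 1), ∫⁻ v in Ioc (squareVertex 3) (squareVertex 4),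
        f u v =
      ∫⁻ u in Ioc (squareVertex 0) (squareVertex 1), ∫⁻ v in Ioc (squareVertex 1) (squareVertex 2),
        f u v := by
  have hturn (u v : ℝ) : f u (v + 3 * π / 2) = f v (u + π / 2) := by
    have hfull : v + 3 * π / 2 + π / 2 = v + 2 * π := by ring
    rw [← hrot, hfull, hper, hswap]
  have h3 : squareVertex 3 = squareVertex 0 + 3 * π / 2 := by simp only [squareVertex_succ]; ring
  have h4 : squareVertex 4 = squareVertex 1 + 3 * π / 2 := by simp only [squareVertex_succ]; ring
  have hcomp : Measurable fun p : ℝ × ℝ => f p.2 (p.1 + π / 2) :=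
    hf.comp (by fun_prop : Measurable fun p : ℝ × ℝ => (p.2, p.1 + π / 2))
  simp only [h3, h4, ← setLIntegral_Ioc_comp_add_right, hturn]
  rw [lintegral_lintegral_swap hcomp.aemeasurable]
  simp only [setLIntegral_Ioc_comp_add_right, ← squareVertex_succ]

theorem setLIntegral_kinematicSpace_of_symmetric {f : ℝ → ℝ → ℝ≥0∞}
    (hf : Measurable (Function.uncurry f)) (hswap : ∀ u v, f v u = f u v)
    (hper : ∀ u v, f u (v + 2 * π) = f u v) (hrot : ∀ u v, f (u + π / 2) (v + π / 2) = f u v)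
    (hzero : ∀ u ∈ Ioo (squareVertex 0) (squareVertex 1),
      ∀ v ∈ Ioo (squareVertex 0) (squareVertex 1), f u v = 0) :
    ∫⁻ p in kinematicSpace, f p.1 p.2 =
      4 * (2 * (∫⁻ p in squareI, f p.1 p.2) + ∫⁻ p in squareII, f p.1 p.2) := by
  have hturn : Function.Periodic (fun u => ∫⁻ v in Ioc (squareVertex 0) (squareVertex 4), f u v)
      (π / 2) := fun u => by
    have h4 : squareVertex 4 = squareVertex 0 + 2 * π := rfl
    simp only [h4, ← setLIntegral_Ioc_add_eq_of_periodic two_pi_pos (hper _)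
      (squareVertex 0 + π / 2), add_right_comm _ (π / 2) (2 * π),
      ← setLIntegral_Ioc_comp_add_right, hrot]
  have hsame : ∫⁻ u in Ioc (squareVertex 0) (squareVertex 1),
      ∫⁻ v in Ioc (squareVertex 0) (squareVertex 1), f u v = 0 := by
    rw [← lintegral_zero]
    refine lintegral_congr_ae ((ae_restrict_Ioc_mem_Ioo _ _).mono fun u hu => ?_)
    beta_reduce
    rw [← lintegral_zero]
    exact lintegral_congr_ae ((ae_restrict_Ioc_mem_Ioo _ _).mono (hzero u hu))
  have hI : ∫⁻ p in squareI, f p.1 p.2 = ∫⁻ u in Ioc (squareVertex 0) (squareVertex 1),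
      ∫⁻ v in Ioc (squareVertex 1) (squareVertex 2), f u v := setLIntegral_Icc_prod_Icc hf _ _ _ _
  have hII : ∫⁻ p in squareII, f p.1 p.2 = ∫⁻ u in Ioc (squareVertex 0) (squareVertex 1),
      ∫⁻ v in Ioc (squareVertex 2) (squareVertex 3), f u v := setLIntegral_Icc_prod_Icc hf _ _ _ _
  calc ∫⁻ p in kinematicSpace, f p.1 p.2
      = ∫⁻ u in Ioc (squareVertex 0) (squareVertex 4),
          ∫⁻ v in Ioc (squareVertex 0) (squareVertex 4), f u v :=
        setLIntegral_kinematicSpace_of_periodic hf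
          (fun u v => by rw [← hswap, hper, hswap]) hper (squareVertex 0)
    _ = 4 * ∑ i ∈ Finset.range 4, ∫⁻ u in Ioc (squareVertex 0) (squareVertex 1),
          ∫⁻ v in Ioc (squareVertex i) (squareVertex (i + 1)), f u v := by
        have hsides (u : ℝ) := setLIntegral_Ioc_eq_sum
          isVertexSequence_squareVertex.strictMono.monotone (f u) 4
        rw [setLIntegral_eq_four_mul_of_periodic hturn]
        simp only [hsides]
        rw [lintegral_finsetSum _ fun i _ => hf.lintegral_prod_right]
    _ = 4 * (2 * (∫⁻ p in squareI, f p.1 p.2) + ∫⁻ p in squareII, f p.1 p.2) := by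
        simp only [Finset.sum_range_succ, Finset.sum_range_zero, zero_add, Nat.reduceAdd, hsame,
          setLIntegral_fourth_side_eq_second_side hf hswap hper hrot, ← hI, ← hII]
        ring

theorem setLIntegral_kinematicSpace_symmetricShadow (L G : ℝ) :
    ∫⁻ p in kinematicSpace,
        chordLength L symmetricShadow p.1 p.2 * ENNReal.ofReal (croftonDensity L G p.1 p.2) =
      4 * (2 * (∫⁻ p in squareI, chordLength L symmetricShadow p.1 p.2 *
          ENNReal.ofReal (croftonDensity L G p.1 p.2)) +
        ∫⁻ p in squareII, chordLength L symmetricShadow p.1 p.2 *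
          ENNReal.ofReal (croftonDensity L G p.1 p.2)) :=
  setLIntegral_kinematicSpace_of_symmetric
    (f := fun u v => chordLength L symmetricShadow u v * ENNReal.ofReal (croftonDensity L G u v))
    ((measurable_chordLength L measurableSet_symmetricShadow).mul
      (measurable_croftonDensity L G).ennreal_ofReal)
    (fun u v => by simp only [chordLength_swap L _ u, croftonDensity_swap L G u])
    (fun u v => by simp only [chordLength_add_two_pi_right, croftonDensity_add_two_pi_right])
    (fun u v => by simp only [chordLength_symmetricShadow_add_pi_div_two, croftonDensity_add_add])
    fun u hu v hv => by simp only [chordLength_symmetricShadow_eq_zero L hu hv, zero_mul]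

theorem ae_mem_Ioo_prod_Ioo (a b c d : ℝ) :
    ∀ᵐ p : ℝ × ℝ ∂volume.restrict (Icc a b ×ˢ Icc c d), p.1 ∈ Ioo a b ∧ p.2 ∈ Ioo c d := by
  rw [Measure.volume_eq_prod, ← Measure.prod_restrict, ← restrict_Ioo_eq_restrict_Icc,
    ← restrict_Ioo_eq_restrict_Icc, Measure.prod_restrict]
  exact ae_restrict_mem (measurableSet_Ioo.prod measurableSet_Ioo)

theorem integrable_and_integral_eq_toReal {α : Type*} [MeasurableSpace α] {μ : Measure α}
    {f : α → ℝ≥0∞} {g : α → ℝ} (hf : AEMeasurable f μ) (hfin : ∫⁻ x, f x ∂μ ≠ ∞)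
    (hfg : ∀ᵐ x ∂μ, 0 ≤ g x ∧ f x = ENNReal.ofReal (g x)) :
    Integrable g μ ∧ ∫ x, g x ∂μ = (∫⁻ x, f x ∂μ).toReal := by
  have hae : (fun x => (f x).toReal) =ᵐ[μ] g := hfg.mono fun x ⟨hx, hfx⟩ => by
    simp only [hfx, ENNReal.toReal_ofReal hx]
  refine ⟨(integrable_toReal_of_lintegral_ne_top hf hfin).congr hae, ?_⟩
  rw [← integral_congr_ae hae, integral_toReal hf (ae_lt_top' hf hfin)]

theorem integrableOn_lambda_and_integral_eq_toReal {L G ε : ℝ} (hL : 0 ≤ L) (hG : 0 ≤ G)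
    (hε : 0 < ε) {lambda : ℝ → ℝ → ℝ} {a b c d : ℝ} (hbc : b ≤ c) (hda : d ≤ a + 2 * π)
    (hnonneg : ∀ u ∈ Ioo a b, ∀ v ∈ Ioo c d, 0 ≤ lambda u v)
    (hchord : ∀ u ∈ Ioo a b, ∀ v ∈ Ioo c d,
      chordLength L symmetricShadow u v = ENNReal.ofReal (lambda u v))
    (hfin : ∫⁻ p in Icc a b ×ˢ Icc c d, chordLength L symmetricShadow p.1 p.2 *
      ENNReal.ofReal (croftonDensity L G p.1 p.2) ≠ ∞) :
    IntegrableOn (fun p : ℝ × ℝ => lambda p.1 p.2 * crofton L G ε p.1 p.2)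
        (Icc a b ×ˢ Icc c d) ∧
      ∫ p in Icc a b ×ˢ Icc c d, lambda p.1 p.2 * crofton L G ε p.1 p.2 =
        (∫⁻ p in Icc a b ×ˢ Icc c d, chordLength L symmetricShadow p.1 p.2 *
          ENNReal.ofReal (croftonDensity L G p.1 p.2)).toReal := by
  refine integrable_and_integral_eq_toReal
    ((measurable_chordLength L measurableSet_symmetricShadow).mul
      (measurable_croftonDensity L G).ennreal_ofReal).aemeasurable hfin
    ((ae_mem_Ioo_prod_Ioo a b c d).mono fun p ⟨hu, hv⟩ => ?_)
  have hpos := sin_half_sub_pos (hu.2.trans_le (hbc.trans hv.1.le)) (by linarith [hu.1, hv.2])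
  have hlambda := hnonneg _ hu _ hv
  rw [crofton_eq_croftonDensity L G hε hpos.ne', hchord _ hu _ hv, ENNReal.ofReal_mul hlambda]
  exact ⟨mul_nonneg hlambda (croftonDensity_nonneg hL hG _ _), rfl⟩

theorem symmetric_integral_identity {L G ε : ℝ} (hL : 0 ≤ L) (hG : 0 < G) (hε : 0 < ε) :
    IntegrableOn (fun p : ℝ × ℝ => lambdaI L p.1 p.2 * crofton L G ε p.1 p.2) squareI ∧
      IntegrableOn (fun p : ℝ × ℝ => lambdaII L p.1 p.2 * crofton L G ε p.1 p.2) squareII ∧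
      2 * π * L ^ 2 = 8 * G / π *
        (2 * (∫ p in squareI, lambdaI L p.1 p.2 * crofton L G ε p.1 p.2) +
          ∫ p in squareII, lambdaII L p.1 p.2 * crofton L G ε p.1 p.2) := by
  have hπ := pi_pos
  have hvolume : sliceVolume L symmetricShadow = ENNReal.ofReal (2 * π * L ^ 2) :=
    sliceVolume_causalShadow (by linarith) (by linarith) (by linarith) (by linarith) L
  have htotal := setLIntegral_kinematicSpace_symmetricShadow L G
  rw [setLIntegral_kinematicSpace_chordLength measurableSet_symmetricShadow hL hG, hvolume,
    ← ENNReal.ofReal_mul (by positivity)] at htotal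
  set X := ∫⁻ p in squareI, chordLength L symmetricShadow p.1 p.2 *
    ENNReal.ofReal (croftonDensity L G p.1 p.2)
  set Y := ∫⁻ p in squareII, chordLength L symmetricShadow p.1 p.2 *
    ENNReal.ofReal (croftonDensity L G p.1 p.2)
  have hfin : 2 * X + Y ≠ ∞ :=
    (ENNReal.lt_top_of_mul_ne_top_right (htotal ▸ ENNReal.ofReal_ne_top) four_ne_zero).ne
  obtain ⟨h2X, hY⟩ := ENNReal.add_ne_top.mp hfin
  have hX : X ≠ ∞ := (ENNReal.lt_top_of_mul_ne_top_right h2X two_ne_zero).ne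
  obtain ⟨hintI, hI⟩ := integrableOn_lambda_and_integral_eq_toReal hL hG.le hε le_rfl
    (by linarith) (fun u hu v hv => lambdaI_nonneg hL hu hv)
    (fun u hu v hv => chordLength_symmetricShadow_eq_lambdaI hL hu hv) hX
  obtain ⟨hintII, hII⟩ := integrableOn_lambda_and_integral_eq_toReal hL hG.le hε (by linarith)
    (by linarith) (fun u hu v hv => lambdaII_nonneg hL hu hv)
    (fun u hu v hv => chordLength_symmetricShadow_eq_lambdaII hL hu hv) hY
  have hreal : π / (2 * G) * (2 * π * L ^ 2) = 4 * (2 * X.toReal + Y.toReal) := by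
    rw [← ENNReal.toReal_ofReal (by positivity : 0 ≤ π / (2 * G) * (2 * π * L ^ 2)), htotal]
    simp only [ENNReal.toReal_mul, ENNReal.toReal_add h2X hY, ENNReal.toReal_ofNat]
  refine ⟨hintI, hintII, ?_⟩
  calc 2 * π * L ^ 2 = 2 * G / π * (π / (2 * G) * (2 * π * L ^ 2)) := by field_simp
    _ = 8 * G / π * (2 * X.toReal + Y.toReal) := by rw [hreal]; ring
    _ = _ := by rw [squareI, squareII, hI, hII]; rfl

theorem setLIntegral_kinematicRegion_causalShadow {L G ε : ℝ} (hL : 0 ≤ L) (hG : 0 < G)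
    (hε : 0 < ε) {a₁ b₁ a₂ b₂ : ℝ} (h₁ : a₁ < b₁) (h₂ : b₁ < a₂) (h₃ : a₂ < b₂)
    (h₄ : b₂ < a₁ + 2 * π) :
    ENNReal.ofReal (2 * G / π) *
        (∫⁻ p in kinematicRegion (causalShadow a₁ b₁ a₂ b₂),
          chordLength L (causalShadow a₁ b₁ a₂ b₂) p.1 p.2 *
            ENNReal.ofReal (crofton L G ε p.1 p.2)) =
      ENNReal.ofReal (2 * π * L ^ 2) := by
  have := pi_pos
  have hconst : 2 * G / π * (π / (2 * G)) = 1 := by field_simp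
  rw [setLIntegral_kinematicRegion (measurableSet_causalShadow h₁ h₂ h₃ h₄) hL hG hε,
    sliceVolume_causalShadow h₁ h₂ h₃ h₄, ← mul_assoc, ← ENNReal.ofReal_mul (by positivity),
    hconst, ENNReal.ofReal_one, one_mul]

theorem mainTheorem2 (L G ε : ℝ) (hL : 0 < L) (hG : 0 < G) (hε : 0 < ε) :
    -- the integral identity at the symmetric phase transition
    (IntegrableOn (fun p : ℝ × ℝ => lambdaI L p.1 p.2 * crofton L G ε p.1 p.2) squareI ∧
      IntegrableOn (fun p : ℝ × ℝ => lambdaII L p.1 p.2 * crofton L G ε p.1 p.2) squareII ∧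
      2 * π * L ^ 2 = 8 * G / π *
        (2 * (∫ p in squareI, lambdaI L p.1 p.2 * crofton L G ε p.1 p.2) +
          ∫ p in squareII, lambdaII L p.1 p.2 * crofton L G ε p.1 p.2)) ∧
    -- the Crofton density in light-cone coordinates
    (∀ u v : ℝ, u < v → v < u + 2 * π →
      crofton L G ε u v = L / (4 * G) * (1 / (2 * Real.sin ((v - u) / 2) ^ 2))) ∧
    -- the functions being integrated are the chords of the causal shadow
    (∀ u v : ℝ, (u, v) ∈ interior squareI →
      chordLength L symmetricShadow u v = ENNReal.ofReal (lambdaI L u v)) ∧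
    (∀ u v : ℝ, (u, v) ∈ interior squareII →
      chordLength L symmetricShadow u v = ENNReal.ofReal (lambdaII L u v)) ∧
    -- the kinematic space integral is the volume of the causal shadow, whatever the placement
    (∀ a₁ b₁ a₂ b₂ : ℝ, a₁ < b₁ → b₁ < a₂ → a₂ < b₂ → b₂ < a₁ + 2 * π →
      sliceVolume L (causalShadow a₁ b₁ a₂ b₂) = ENNReal.ofReal (2 * π * L ^ 2) ∧
      ENNReal.ofReal (2 * G / π) *
          (∫⁻ p in kinematicRegion (causalShadow a₁ b₁ a₂ b₂),
            chordLength L (causalShadow a₁ b₁ a₂ b₂) p.1 p.2 *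
              ENNReal.ofReal (crofton L G ε p.1 p.2)) =
        ENNReal.ofReal (2 * π * L ^ 2)) := by
  refine ⟨symmetric_integral_identity hL.le hG hε,
    fun u v h h' => crofton_eq_croftonDensity L G hε (sin_half_sub_pos h h').ne',
    fun u v h => ?_, fun u v h => ?_, fun a₁ b₁ a₂ b₂ h₁ h₂ h₃ h₄ =>
      ⟨sliceVolume_causalShadow h₁ h₂ h₃ h₄ L,
        setLIntegral_kinematicRegion_causalShadow hL.le hG hε h₁ h₂ h₃ h₄⟩⟩
  · rw [squareI, interior_prod_eq, interior_Icc, interior_Icc] at h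
    exact chordLength_symmetricShadow_eq_lambdaI hL.le h.1 h.2
  · rw [squareII, interior_prod_eq, interior_Icc, interior_Icc] at h
    exact chordLength_symmetricShadow_eq_lambdaII hL.le h.1 h.2
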